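/- **Setting.** All graphs are finite. For a DAG $G$ let $\mathrm{Free}_G$ be the Markov category freely generated by the nodes of $G$ as objects and one box $\mathrm{pa}^G(a)\to a$ for every node $a$ as morphisms. A Markov functor is a strict symmetric monoidal functor between Markov categories that preserves copying and discarding; a causal model over $G$ is a Markov functor $F:\mathrm{Free}_G\to M$ into a Markov category $M$. Let $\mathrm{restr}(\mathrm{Free}_G)$ consist of the morphisms given by a string diagram in which every box appears at most once; such a morphism $X\to Y$ is called interventional (it represents $p(Y\mid do(X))$) if it is given by a string diagram in which every node is generated at most once, input wires being counted along with boxes. We say that a Markov functor $\iota:\mathrm{Free}_{H}\to\mathrm{Free}_{G}$ embeds $\mathrm{restr}(\mathrm{Free}_{H})$ into $\mathrm{restr}(\mathrm{Free}_{G})$ if it is injective on objects, maps $\mathrm{restr}(\mathrm{Free}_H)$ into $\mathrm{restr}(\mathrm{Free}_G)$ and interventional morphisms to interventional morphisms, and is injective on the interventional morphisms between any two objects. A DAG $H$ is a graphical abstraction of a DAG $G$ if it results from $G$ (up to renaming of nodes) by a sequence of the following operations: (a) deleting a node that does not have outgoing edges to two different nodes, and adding edges from all its parents to all its children; (b) merging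 two nodes, combining their incoming and their outgoing edges, provided that the result is acyclic. Every node $w$ of $H$ then comes from a cluster of nodes of $G$, namely those merged into $w$. Let $G$ be a DAG whose nodes are divided into endogenous nodes $V$ and exogenous nodes $U$, where exogenous nodes have no parents. The latent projection of $G$ is the acyclic directed mixed graph (ADMG) on $V$ with an edge $v\to w$ if $G$ has a directed path from $v$ to $w$ with all intermediate nodes in $U$, and an edge $v\leftrightarrow w$ ($v\ne w$) if some node of $U$ has directed paths to both $v$ and $w$ with all intermediate nodes in $U$. A causal model $F$ over $G$ is a causal model over the ADMG $L$ if the nodes of $G$ can be divided in this way so that $L$ is the latent projection of $G$. **Lemma.** Let $F_{L'}:\mathrm{Free}_{L'}\to M$ be a causal model over a DAG $L'$ with endogenous nodes $V$ and exogenous nodes $U$ that is a causal model over the ADMG $L$ on $V$, and let $H$ be an ADMG on a set $W$ that is a graphical abstraction between ADMGs of $L$, in the following sense: there are DAGs $L''$ and $H''$, with nodes divided into endogenous and exogenous ones, whose latent projections are $L$ and $H$, such that $H''$ is a graphical abstraction of $L''$, and 1. the exogenous nodes of $L''$ are never merged with other nodes in the sequence of operations leading from $L''$ to $H''$, and each $w\in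 W$ comes from a cluster $K(w)\subseteq V$ of endogenous nodes of $L''$; or 2. $L''=L'$ as DAGs, with no restriction on the operations or on the clusters $K(w)\subseteq V\sqcup U$ from which the nodes $w\in W$ come. Then, restricted to a subcategory of $\mathrm{Free}_{L'}$, $F_{L'}$ is a causal model over the ADMG $H$: there are a DAG $H'$ with endogenous nodes $W$ and (finitely many) exogenous nodes, with latent projection $H$, and a Markov functor $\iota:\mathrm{Free}_{H'}\to\mathrm{Free}_{L'}$ that embeds $\mathrm{restr}(\mathrm{Free}_{H'})$ into $\mathrm{restr}(\mathrm{Free}_{L'})$, such that for every $w\in W$ the nodes occurring in the tensor product $\iota(w)$ are exactly those of $K(w)$, and $F_{L'}\circ\iota$ is a causal model over the ADMG $H$. -/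

import Mathlib

open CategoryTheory MonoidalCategory ComonObj

universe u v₁ u₁ v₂ u₂ v₃ u₃

/-! ### Directed acyclic graphs -/

/-- A directed acyclic graph on `V`, given by its parent sets. -/
@[ext]
structure DAG (V : Type u) where
  /-- the set of parents of a node -/
  pa : V → Finset V
  acyclic : ∀ v, ¬ Relation.TransGen (fun x y => x ∈ pa y) v v

namespace DAG

variable {V W : Type u}

/-- There is an edge `x → y`. -/
def Adj (G : DAG V) (x y : V) : Prop := x ∈ G.pa y

/-- `H` arises from `G` by deleting the node `a`, which must not have two outgoing edges to
different nodes, and adding an edge from every parent of `a` to every child of `a`.  The map `e`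
names the remaining nodes. -/
structure IsDeletion (G : DAG V) (a : V) (H : DAG W) (e : W → V) : Prop where
  injective : Function.Injective e
  range_eq : Set.range e = {a}ᶜ
  not_confounder : ∀ x y, G.Adj a x → G.Adj a y → x = y
  adj_iff : ∀ w w', H.Adj w w' ↔
    G.Adj (e w) (e w') ∨ (G.Adj (e w) a ∧ G.Adj a (e w'))

/-- `H` arises from `G` by merging the two nodes `a` and `b`.  The map `f` sends a node of `G` to
the node of `H` that it becomes.  (`H` is a `DAG`, so a merge that creates a cycle is not valid.) -/
structure IsMerging (G : DAG V) (a b : V) (H : DAG W) (f : V → W) : Prop where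
  ne : a ≠ b
  surjective : Function.Surjective f
  eq_iff : ∀ x y, f x = f y ↔ x = y ∨ (x = a ∧ y = b) ∨ (x = b ∧ y = a)
  adj_iff : ∀ w w', H.Adj w w' ↔ w ≠ w' ∧ ∃ x y, f x = w ∧ f y = w' ∧ G.Adj x y

/-- `G.AbstractsTo X H cl`: the DAG `H` results from `G` by a sequence of deletions and mergings
(up to renaming of nodes) in which no node belonging to `X` is ever merged with another node;
`cl w` is the cluster of those nodes of `G` that have been merged into the node `w` of `H`.
For `X = ∅` there is no restriction, and `H` is an arbitrary graphical abstraction of `G`. -/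
inductive AbstractsTo (G : DAG V) (X : Set V) : {W : Type u} → DAG W → (W → Set V) → Prop
  | rename {W : Type u} (H : DAG W) (e : W ≃ V)
      (h : ∀ w w', H.Adj w w' ↔ G.Adj (e w) (e w')) :
      AbstractsTo G X H (fun w => {e w})
  | delete {W W' : Type u} {H : DAG W} {cl : W → Set V} {H' : DAG W'} (a : W) (e : W' → W)
      (hH : AbstractsTo G X H cl) (h : H.IsDeletion a H' e) :
      AbstractsTo G X H' (fun w => cl (e w))
  | merge {W W' : Type u} {H : DAG W} {cl : W → Set V} {H' : DAG W'} (a b : W) (f : W → W')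
      (hH : AbstractsTo G X H cl) (ha : Disjoint (cl a) X) (hb : Disjoint (cl b) X)
      (h : H.IsMerging a b H' f) :
      AbstractsTo G X H' (fun w => {n | ∃ x, f x = w ∧ n ∈ cl x})

end DAG

/-! ### Acyclic directed mixed graphs and latent projections -/

/-- An acyclic directed mixed graph on `V`. -/
@[ext]
structure ADMG (V : Type u) where
  /-- directed edges -/
  Dir : V → V → Prop
  /-- bidirected edges -/
  Bidir : V → V → Prop
  acyclic : ∀ v, ¬ Relation.TransGen Dir v v
  symm : ∀ v w, Bidir v w → Bidir w v
  irrefl : ∀ v, ¬ Bidir v v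

namespace DAG

variable {V U W : Type u}

/-- There is a directed path, with at least one edge, from `x` to the node `v ∈ V`, all of whose
intermediate nodes lie in `U`. -/
inductive LatentPath (G : DAG (V ⊕ U)) : V ⊕ U → V → Prop
  | edge {x : V ⊕ U} {v : V} (h : G.Adj x (Sum.inl v)) : LatentPath G x v
  | step {x : V ⊕ U} {w : U} {v : V} (h : G.Adj x (Sum.inr w))
      (p : LatentPath G (Sum.inr w) v) : LatentPath G x v

theorem LatentPath.transGen {G : DAG (V ⊕ U)} {x : V ⊕ U} {v : V} (h : G.LatentPath x v) :
    Relation.TransGen (fun a b => a ∈ G.pa b) x (Sum.inl v) := by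
  induction h with
  | edge h => exact .single h
  | step h _ ih => exact .head h ih

/-- The latent projection onto `V` of a DAG with nodes `V ⊔ U`: there is an edge `v → w` if there
is a directed path from `v` to `w` through `U`, and an edge `v ↔ w` if some node of `U` has directed
paths through `U` to both `v` and `w`. -/
def latentProjection (G : DAG (V ⊕ U)) : ADMG V where
  Dir v w := G.LatentPath (Sum.inl v) w
  Bidir v w := v ≠ w ∧ ∃ x : U, G.LatentPath (Sum.inr x) v ∧ G.LatentPath (Sum.inr x) w
  acyclic v h := by
    refine G.acyclic (Sum.inl v) ?_
    have key : ∀ a b : V, Relation.TransGen (fun v w => G.LatentPath (Sum.inl v) w) a b →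
        Relation.TransGen (fun a b => a ∈ G.pa b) (Sum.inl a) (Sum.inl b) := by
      intro a b hab
      induction hab with
      | single h => exact h.transGen
      | tail _ h ih => exact ih.trans h.transGen
    exact key v v h
  symm := fun _ _ h => ⟨h.1.symm, h.2.imp fun _ hx => ⟨hx.2, hx.1⟩⟩
  irrefl := fun _ h => h.1 rfl

/-- The nodes of the DAG `G` are divided into endogenous nodes `V` and exogenous (that is,
parentless) nodes `U`, and the ADMG `L` is its latent projection onto `V`. -/
structure Represents (G : DAG (V ⊕ U)) (L : ADMG V) : Prop where
  exogenous : ∀ x : U, G.pa (Sum.inr x) = ∅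
  latentProjection_eq : G.latentProjection = L

end DAG

/-- `H` is a graphical abstraction between ADMGs of `L`: there are DAGs `L₁`, `H₁` with latent
projections `L`, `H` such that `H₁` is a graphical abstraction of `L₁`, where exogenous nodes are
never merged and the node `w` of `H` is obtained from the cluster `K w` of nodes of `L`. -/
def ADMG.IsGraphicalAbstraction {V W : Type u} (L : ADMG V) (H : ADMG W) (K : W → Set V) : Prop :=
  ∃ (U₁ U₂ : Type u) (_ : Finite U₁) (_ : Finite U₂) (L₁ : DAG (V ⊕ U₁)) (H₁ : DAG (W ⊕ U₂))
    (cl : W ⊕ U₂ → Set (V ⊕ U₁)),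
    L₁.Represents L ∧ H₁.Represents H ∧ L₁.AbstractsTo (Set.range Sum.inr) H₁ cl ∧
      ∀ w, cl (Sum.inl w) = Sum.inl '' K w

/-- The ADMG `H` is the latent projection of some graphical abstraction of the DAG `G`, with no
restriction on the mergings; the node `w` of `H` is obtained from the cluster `K w` of nodes
of `G`. -/
def DAG.HasADMGAbstraction {V W : Type u} (G : DAG V) (H : ADMG W) (K : W → Set V) : Prop :=
  ∃ (U₂ : Type u) (_ : Finite U₂) (H₁ : DAG (W ⊕ U₂)) (cl : W ⊕ U₂ → Set V),
    H₁.Represents H ∧ G.AbstractsTo ∅ H₁ cl ∧ ∀ w, cl (Sum.inl w) = K w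

/-! ### Markov functors -/

/-- A Markov functor: a strict symmetric monoidal functor between Markov categories that preserves
copying and discarding.  Strictness means that the structure morphisms are identities. -/
structure MarkovFunctor (C : Type u₁) [Category.{v₁} C] [MonoidalCategory.{v₁} C]
    [MarkovCategory C] (D : Type u₂) [Category.{v₂} D] [MonoidalCategory.{v₂} D]
    [MarkovCategory D] where
  /-- the underlying functor -/
  toFunctor : C ⥤ D
  /-- its symmetric monoidal structure -/
  [braided : toFunctor.Braided]
  obj_unit : 𝟙_ D = toFunctor.obj (𝟙_ C)
  obj_tensor : ∀ X Y : C, toFunctor.obj X ⊗ toFunctor.obj Y = toFunctor.obj (X ⊗ Y)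
  unit_eq : Functor.LaxMonoidal.ε toFunctor = eqToHom obj_unit
  tensor_eq : ∀ X Y : C, Functor.LaxMonoidal.μ toFunctor X Y = eqToHom (obj_tensor X Y)
  map_copy : ∀ X : C,
    toFunctor.map Δ[X] = Δ[toFunctor.obj X] ≫ Functor.LaxMonoidal.μ toFunctor X X
  map_discard : ∀ X : C,
    toFunctor.map ε[X] = ε[toFunctor.obj X] ≫ Functor.LaxMonoidal.ε toFunctor

attribute [instance] MarkovFunctor.braided

namespace MarkovFunctor

variable {C : Type u₁} [Category.{v₁} C] [MonoidalCategory.{v₁} C] [MarkovCategory C]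
  {D : Type u₂} [Category.{v₂} D] [MonoidalCategory.{v₂} D] [MarkovCategory D]
  {E : Type u₃} [Category.{v₃} E] [MonoidalCategory.{v₃} E] [MarkovCategory E]

/-- Composition of Markov functors. -/
def comp (F : MarkovFunctor C D) (G : MarkovFunctor D E) : MarkovFunctor C E where
  toFunctor := F.toFunctor ⋙ G.toFunctor
  obj_unit := G.obj_unit.trans (congrArg _ F.obj_unit)
  obj_tensor X Y := (G.obj_tensor _ _).trans (congrArg _ (F.obj_tensor X Y))
  unit_eq := by simp [F.unit_eq, G.unit_eq, eqToHom_map]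
  tensor_eq X Y := by simp [F.tensor_eq, G.tensor_eq, eqToHom_map]
  map_copy X := by simp [F.map_copy, G.map_copy]
  map_discard X := by simp [F.map_discard, G.map_discard]

end MarkovFunctor

/-! ### The free Markov category of a DAG -/

/-- The objects of the Markov category freely generated by a DAG: formal tensor products of
nodes. -/
inductive FreeMarkov {V : Type u} (G : DAG V) : Type u
  | of (v : V) : FreeMarkov G
  | unit : FreeMarkov G
  | tensor (X Y : FreeMarkov G) : FreeMarkov G

namespace FreeMarkov

variable {V : Type u} {G : DAG V}

/-- The nodes occurring in a formal tensor product, from left to right. -/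
def nodes : FreeMarkov G → List V
  | of v => [v]
  | unit => []
  | tensor X Y => nodes X ++ nodes Y

/-- The formal tensor product of a list of nodes. -/
def tensorList (G : DAG V) : List V → FreeMarkov G
  | [] => unit
  | v :: l => tensor (of v) (tensorList G l)

/-- String diagrams over a DAG, as formal composites of the structure morphisms of a Markov
category and of one generating box `pa(a) → a` for every node `a`. -/
inductive Diagram (G : DAG V) : FreeMarkov G → FreeMarkov G → Type u
  | box (a : V) : Diagram G (tensorList G (G.pa a).toList) (of a)
  | id (X) : Diagram G X X
  | comp {X Y Z} (f : Diagram G X Y) (g : Diagram G Y Z) : Diagram G X Z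
  | whiskerLeft (X) {Y Z} (f : Diagram G Y Z) : Diagram G (tensor X Y) (tensor X Z)
  | whiskerRight {X Y} (f : Diagram G X Y) (Z) : Diagram G (tensor X Z) (tensor Y Z)
  | assoc (X Y Z) : Diagram G (tensor (tensor X Y) Z) (tensor X (tensor Y Z))
  | assocInv (X Y Z) : Diagram G (tensor X (tensor Y Z)) (tensor (tensor X Y) Z)
  | leftUnit (X) : Diagram G (tensor unit X) X
  | leftUnitInv (X) : Diagram G X (tensor unit X)
  | rightUnit (X) : Diagram G (tensor X unit) X
  | rightUnitInv (X) : Diagram G X (tensor X unit)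
  | swap (X Y) : Diagram G (tensor X Y) (tensor Y X)
  | copy (X) : Diagram G X (tensor X X)
  | discard (X) : Diagram G X unit

namespace Diagram

/-- The generating boxes (labelled by nodes) occurring in a diagram, with multiplicity. -/
def boxes : {X Y : FreeMarkov G} → Diagram G X Y → List V
  | _, _, box a => [a]
  | _, _, comp f g => boxes f ++ boxes g
  | _, _, whiskerLeft _ f => boxes f
  | _, _, whiskerRight f _ => boxes f
  | _, _, id _ => []
  | _, _, assoc _ _ _ => []
  | _, _, assocInv _ _ _ => []
  | _, _, leftUnit _ => []
  | _, _, leftUnitInv _ => []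
  | _, _, rightUnit _ => []
  | _, _, rightUnitInv _ => []
  | _, _, swap _ _ => []
  | _, _, copy _ => []
  | _, _, discard _ => []

/-- The middle-four interchange `(X₁ ⊗ X₂) ⊗ (Y₁ ⊗ Y₂) → (X₁ ⊗ Y₁) ⊗ (X₂ ⊗ Y₂)`. -/
def middleSwap (X₁ X₂ Y₁ Y₂ : FreeMarkov G) :
    Diagram G (tensor (tensor X₁ X₂) (tensor Y₁ Y₂)) (tensor (tensor X₁ Y₁) (tensor X₂ Y₂)) :=
  (assoc X₁ X₂ (tensor Y₁ Y₂)).comp <|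
    (whiskerLeft X₁ (assocInv X₂ Y₁ Y₂)).comp <|
      (whiskerLeft X₁ (whiskerRight (swap X₂ Y₁) Y₂)).comp <|
        (whiskerLeft X₁ (assoc Y₁ X₂ Y₂)).comp (assocInv X₁ Y₁ (tensor X₂ Y₂))

/-- Equality of string diagrams: the congruence generated by the axioms of a Markov category. -/
inductive Rel : {X Y : FreeMarkov G} → Diagram G X Y → Diagram G X Y → Prop
  -- equivalence relation and congruence
  | refl {X Y} (f : Diagram G X Y) : Rel f f
  | symm {X Y} {f g : Diagram G X Y} : Rel f g → Rel g f
  | trans {X Y} {f g h : Diagram G X Y} : Rel f g → Rel g h → Rel f h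
  | comp {X Y Z} {f f' : Diagram G X Y} {g g' : Diagram G Y Z} :
      Rel f f' → Rel g g' → Rel (f.comp g) (f'.comp g')
  | whiskerLeft (X) {Y Z} {f f' : Diagram G Y Z} :
      Rel f f' → Rel (f.whiskerLeft X) (f'.whiskerLeft X)
  | whiskerRight {X Y} {f f' : Diagram G X Y} (Z) :
      Rel f f' → Rel (f.whiskerRight Z) (f'.whiskerRight Z)
  -- category
  | id_comp {X Y} (f : Diagram G X Y) : Rel ((id X).comp f) f
  | comp_id {X Y} (f : Diagram G X Y) : Rel (f.comp (id Y)) f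
  | comp_assoc {W X Y Z} (f : Diagram G W X) (g : Diagram G X Y) (h : Diagram G Y Z) :
      Rel ((f.comp g).comp h) (f.comp (g.comp h))
  -- bifunctoriality of the tensor product
  | whiskerLeft_id (X Y) : Rel ((id Y).whiskerLeft X) (id (tensor X Y))
  | id_whiskerRight (X Y) : Rel ((id X).whiskerRight Y) (id (tensor X Y))
  | whiskerLeft_comp (W) {X Y Z} (f : Diagram G X Y) (g : Diagram G Y Z) :
      Rel ((f.comp g).whiskerLeft W) ((f.whiskerLeft W).comp (g.whiskerLeft W))
  | comp_whiskerRight {W X Y} (f : Diagram G W X) (g : Diagram G X Y) (Z) :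
      Rel ((f.comp g).whiskerRight Z) ((f.whiskerRight Z).comp (g.whiskerRight Z))
  | exchange {W X Y Z} (f : Diagram G W X) (g : Diagram G Y Z) :
      Rel ((g.whiskerLeft W).comp (f.whiskerRight Z)) ((f.whiskerRight Y).comp (g.whiskerLeft X))
  -- associator and unitors
  | assoc_hom_inv (X Y Z) : Rel ((assoc X Y Z).comp (assocInv X Y Z)) (id _)
  | assoc_inv_hom (X Y Z) : Rel ((assocInv X Y Z).comp (assoc X Y Z)) (id _)
  | leftUnit_hom_inv (X) : Rel ((leftUnit X).comp (leftUnitInv X)) (id _)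
  | leftUnit_inv_hom (X) : Rel ((leftUnitInv X).comp (leftUnit X)) (id _)
  | rightUnit_hom_inv (X) : Rel ((rightUnit X).comp (rightUnitInv X)) (id _)
  | rightUnit_inv_hom (X) : Rel ((rightUnitInv X).comp (rightUnit X)) (id _)
  | assoc_nat_left {X X'} (f : Diagram G X X') (Y Z) :
      Rel (((f.whiskerRight Y).whiskerRight Z).comp (assoc X' Y Z))
        ((assoc X Y Z).comp (f.whiskerRight (tensor Y Z)))
  | assoc_nat_middle (X) {Y Y'} (f : Diagram G Y Y') (Z) :
      Rel (((f.whiskerLeft X).whiskerRight Z).comp (assoc X Y' Z))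
        ((assoc X Y Z).comp ((f.whiskerRight Z).whiskerLeft X))
  | assoc_nat_right (X Y) {Z Z'} (f : Diagram G Z Z') :
      Rel ((f.whiskerLeft (tensor X Y)).comp (assoc X Y Z'))
        ((assoc X Y Z).comp ((f.whiskerLeft Y).whiskerLeft X))
  | leftUnit_nat {X Y} (f : Diagram G X Y) :
      Rel ((f.whiskerLeft unit).comp (leftUnit Y)) ((leftUnit X).comp f)
  | rightUnit_nat {X Y} (f : Diagram G X Y) :
      Rel ((f.whiskerRight unit).comp (rightUnit Y)) ((rightUnit X).comp f)
  | pentagon (W X Y Z) :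
      Rel (((assoc W X Y).whiskerRight Z).comp
          ((assoc W (tensor X Y) Z).comp ((assoc X Y Z).whiskerLeft W)))
        ((assoc (tensor W X) Y Z).comp (assoc W X (tensor Y Z)))
  | triangle (X Y) :
      Rel ((assoc X unit Y).comp ((leftUnit Y).whiskerLeft X)) ((rightUnit X).whiskerRight Y)
  -- symmetry
  | swap_swap (X Y) : Rel ((swap X Y).comp (swap Y X)) (id _)
  | swap_nat_right (X) {Y Z} (f : Diagram G Y Z) :
      Rel ((f.whiskerLeft X).comp (swap X Z)) ((swap X Y).comp (f.whiskerRight X))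
  | swap_nat_left {X Y} (f : Diagram G X Y) (Z) :
      Rel ((f.whiskerRight Z).comp (swap Y Z)) ((swap X Z).comp (f.whiskerLeft Z))
  | hexagon_forward (X Y Z) :
      Rel ((assoc X Y Z).comp ((swap X (tensor Y Z)).comp (assoc Y Z X)))
        (((swap X Y).whiskerRight Z).comp ((assoc Y X Z).comp ((swap X Z).whiskerLeft Y)))
  | hexagon_reverse (X Y Z) :
      Rel ((assocInv X Y Z).comp ((swap (tensor X Y) Z).comp (assocInv Z X Y)))
        (((swap Y Z).whiskerLeft X).comp ((assocInv X Z Y).comp ((swap X Z).whiskerRight Y)))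
  -- commutative comonoids
  | copy_discard_left (X) : Rel ((copy X).comp ((discard X).whiskerRight X)) (leftUnitInv X)
  | copy_discard_right (X) : Rel ((copy X).comp ((discard X).whiskerLeft X)) (rightUnitInv X)
  | copy_assoc (X) :
      Rel ((copy X).comp ((copy X).whiskerLeft X))
        ((copy X).comp (((copy X).whiskerRight X).comp (assoc X X X)))
  | copy_swap (X) : Rel ((copy X).comp (swap X X)) (copy X)
  -- compatibility of the comonoids with the tensor product
  | copy_tensor (X Y) :
      Rel (copy (tensor X Y))
        ((((copy X).whiskerRight Y).comp ((copy Y).whiskerLeft (tensor X X))).comp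
          (middleSwap X X Y Y))
  | discard_tensor (X Y) :
      Rel (discard (tensor X Y))
        ((((discard X).whiskerRight Y).comp ((discard Y).whiskerLeft unit)).comp (leftUnit unit))
  | copy_unit : Rel (copy (G := G) unit) (leftUnitInv unit)
  | discard_unit : Rel (discard (G := G) unit) (id unit)
  -- the unit is terminal
  | discard_nat {X Y} (f : Diagram G X Y) : Rel (f.comp (discard Y)) (discard X)

instance setoid (X Y : FreeMarkov G) : Setoid (Diagram G X Y) :=
  ⟨Rel, Rel.refl, Rel.symm, Rel.trans⟩

end Diagram

open Diagram

instance : Category.{u} (FreeMarkov G) where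
  Hom X Y := Quotient (Diagram.setoid X Y)
  id X := ⟦Diagram.id X⟧
  comp f g := Quotient.map₂ Diagram.comp (fun _ _ h _ _ h' => Rel.comp h h') f g
  id_comp := by rintro X Y ⟨f⟩; exact Quotient.sound (Rel.id_comp f)
  comp_id := by rintro X Y ⟨f⟩; exact Quotient.sound (Rel.comp_id f)
  assoc := by rintro W X Y Z ⟨f⟩ ⟨g⟩ ⟨h⟩; exact Quotient.sound (Rel.comp_assoc f g h)

/-- The morphism of the free Markov category given by a string diagram. -/
def homMk {X Y : FreeMarkov G} (f : Diagram G X Y) : X ⟶ Y := Quotient.mk _ f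

theorem homMk_sound {X Y : FreeMarkov G} {f g : Diagram G X Y} (h : Rel f g) :
    homMk f = homMk g := Quotient.sound h

theorem homMk_comp {X Y Z : FreeMarkov G} (f : Diagram G X Y) (g : Diagram G Y Z) :
    homMk (f.comp g) = homMk f ≫ homMk g := rfl

instance : MonoidalCategoryStruct (FreeMarkov G) where
  tensorObj := tensor
  tensorUnit := unit
  whiskerLeft X _ _ f :=
    Quotient.map (Diagram.whiskerLeft X) (fun _ _ h => Rel.whiskerLeft X h) f
  whiskerRight f Z :=
    Quotient.map (fun d => Diagram.whiskerRight d Z) (fun _ _ h => Rel.whiskerRight Z h) f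
  associator X Y Z := ⟨homMk (Diagram.assoc X Y Z), homMk (assocInv X Y Z),
    homMk_sound (Rel.assoc_hom_inv X Y Z), homMk_sound (Rel.assoc_inv_hom X Y Z)⟩
  leftUnitor X := ⟨homMk (leftUnit X), homMk (leftUnitInv X),
    homMk_sound (Rel.leftUnit_hom_inv X), homMk_sound (Rel.leftUnit_inv_hom X)⟩
  rightUnitor X := ⟨homMk (rightUnit X), homMk (rightUnitInv X),
    homMk_sound (Rel.rightUnit_hom_inv X), homMk_sound (Rel.rightUnit_inv_hom X)⟩

instance : MonoidalCategory (FreeMarkov G) where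
  tensorHom_def _ _ := rfl
  id_tensorHom_id X Y :=
    homMk_sound (((Rel.id_whiskerRight X Y).comp (Rel.whiskerLeft_id X Y)).trans (Rel.id_comp _))
  tensorHom_comp_tensorHom := by
    rintro X₁ Y₁ Z₁ X₂ Y₂ Z₂ ⟨f₁⟩ ⟨f₂⟩ ⟨g₁⟩ ⟨g₂⟩
    refine homMk_sound (f := ((f₁.whiskerRight X₂).comp (f₂.whiskerLeft Y₁)).comp
      ((g₁.whiskerRight Y₂).comp (g₂.whiskerLeft Z₁)))
      (g := ((f₁.comp g₁).whiskerRight X₂).comp ((f₂.comp g₂).whiskerLeft Z₁)) ?_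
    refine Rel.trans ?_ (Rel.comp (Rel.comp_whiskerRight f₁ g₁ X₂)
      (Rel.whiskerLeft_comp Z₁ f₂ g₂)).symm
    refine (Rel.comp_assoc _ _ _).trans (Rel.trans ?_ (Rel.comp_assoc _ _ _).symm)
    refine (Rel.refl _).comp ?_
    refine (Rel.comp_assoc _ _ _).symm.trans (Rel.trans ?_ (Rel.comp_assoc _ _ _))
    exact (Rel.exchange g₁ f₂).comp (Rel.refl _)
  whiskerLeft_id X Y := homMk_sound (Rel.whiskerLeft_id X Y)
  id_whiskerRight X Y := homMk_sound (Rel.id_whiskerRight X Y)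
  associator_naturality := by
    rintro X₁ X₂ X₃ Y₁ Y₂ Y₃ ⟨f₁⟩ ⟨f₂⟩ ⟨f₃⟩
    refine homMk_sound
      (f := ((((f₁.whiskerRight X₂).comp (f₂.whiskerLeft Y₁)).whiskerRight X₃).comp
        (f₃.whiskerLeft (tensor Y₁ Y₂))).comp (Diagram.assoc Y₁ Y₂ Y₃))
      (g := (Diagram.assoc X₁ X₂ X₃).comp ((f₁.whiskerRight (tensor X₂ X₃)).comp
        (((f₂.whiskerRight X₃).comp (f₃.whiskerLeft Y₂)).whiskerLeft Y₁))) ?_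
    refine (Rel.comp_assoc _ _ _).trans ?_
    refine (Rel.comp (Rel.comp_whiskerRight _ _ _) (Rel.assoc_nat_right Y₁ Y₂ f₃)).trans ?_
    refine (Rel.comp_assoc _ _ _).trans ?_
    refine ((Rel.refl _).comp ((Rel.comp_assoc _ _ _).symm.trans
      (((Rel.assoc_nat_middle Y₁ f₂ X₃).comp (Rel.refl _)).trans (Rel.comp_assoc _ _ _)))).trans ?_
    refine (Rel.comp_assoc _ _ _).symm.trans ?_
    refine ((Rel.assoc_nat_left f₁ X₂ X₃).comp (Rel.whiskerLeft_comp _ _ _).symm).trans ?_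
    exact Rel.comp_assoc _ _ _
  leftUnitor_naturality := by rintro X Y ⟨f⟩; exact homMk_sound (Rel.leftUnit_nat f)
  rightUnitor_naturality := by rintro X Y ⟨f⟩; exact homMk_sound (Rel.rightUnit_nat f)
  pentagon W X Y Z := homMk_sound (Rel.pentagon W X Y Z)
  triangle X Y := homMk_sound (Rel.triangle X Y)

instance : SymmetricCategory (FreeMarkov G) where
  braiding X Y := ⟨homMk (swap X Y), homMk (swap Y X),
    homMk_sound (Rel.swap_swap X Y), homMk_sound (Rel.swap_swap Y X)⟩
  braiding_naturality_right := by rintro X Y Z ⟨f⟩; exact homMk_sound (Rel.swap_nat_right X f)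
  braiding_naturality_left := by rintro X Y ⟨f⟩ Z; exact homMk_sound (Rel.swap_nat_left f Z)
  hexagon_forward X Y Z := homMk_sound (Rel.hexagon_forward X Y Z)
  hexagon_reverse X Y Z := homMk_sound (Rel.hexagon_reverse X Y Z)
  symmetry X Y := homMk_sound (Rel.swap_swap X Y)

instance (X : FreeMarkov G) : ComonObj X where
  counit := homMk (discard X)
  comul := homMk (copy X)
  counit_comul := homMk_sound (Rel.copy_discard_left X)
  comul_counit := homMk_sound (Rel.copy_discard_right X)
  comul_assoc := homMk_sound (Rel.copy_assoc X)

instance (X : FreeMarkov G) : IsCommComonObj X where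
  comul_comm := homMk_sound (Rel.copy_swap X)

/-- `FreeMarkov G` is the Markov category freely generated by the nodes of `G` as objects and the
boxes `pa(a) → a` as morphisms. -/
instance : MarkovCategory (FreeMarkov G) where
  copy_tensor X Y := homMk_sound (Rel.copy_tensor X Y)
  discard_tensor X Y := homMk_sound (Rel.discard_tensor X Y)
  copy_unit := homMk_sound Rel.copy_unit
  discard_unit := homMk_sound Rel.discard_unit
  discard_natural := by rintro X Y ⟨f⟩; exact homMk_sound (Rel.discard_nat f)

/-- `f` is given by a string diagram in which every generating box appears at most once. -/
def UsesBoxesOnce {X Y : FreeMarkov G} (f : X ⟶ Y) : Prop :=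
  ∃ d : Diagram G X Y, homMk d = f ∧ d.boxes.Nodup

/-- `f` is (the string diagram of) a type of interventional distribution `p(Y | do(X))`: it is
given by a string diagram in which every node is generated at most once, either as an input wire
or by its generating box. -/
def IsInterventional {X Y : FreeMarkov G} (f : X ⟶ Y) : Prop :=
  ∃ d : Diagram G X Y, homMk d = f ∧ (X.nodes ++ d.boxes).Nodup

end FreeMarkov

/-- The Markov functor `ι` embeds the restriction of `FreeMarkov H` to the diagrams in which every
box appears at most once into that of `FreeMarkov G`: it is injective on objects, it preserves such
diagrams and the interventional ones, and it is injective on interventional diagrams. -/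
structure MarkovFunctor.EmbedsRestr {V W : Type u} {H : DAG W} {G : DAG V}
    (ι : MarkovFunctor (FreeMarkov H) (FreeMarkov G)) : Prop where
  obj_injective : Function.Injective ι.toFunctor.obj
  map_usesBoxesOnce : ∀ {X Y : FreeMarkov H} (f : X ⟶ Y),
    FreeMarkov.UsesBoxesOnce f → FreeMarkov.UsesBoxesOnce (ι.toFunctor.map f)
  map_interventional : ∀ {X Y : FreeMarkov H} (f : X ⟶ Y),
    FreeMarkov.IsInterventional f → FreeMarkov.IsInterventional (ι.toFunctor.map f)
  injOn_interventional : ∀ {X Y : FreeMarkov H} (f g : X ⟶ Y),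
    FreeMarkov.IsInterventional f → FreeMarkov.IsInterventional g →
      ι.toFunctor.map f = ι.toFunctor.map g → f = g

/-! ### Causal models -/

/-- A causal model over the DAG `G` with values in the Markov category `M`. -/
abbrev CausalModel {V : Type u} (G : DAG V) (M : Type u₁) [Category.{v₁} M]
    [MonoidalCategory.{v₁} M] [MarkovCategory M] :=
  MarkovFunctor (FreeMarkov G) M

namespace CausalModel

variable {V U W : Type u} {M : Type u₁} [Category.{v₁} M] [MonoidalCategory.{v₁} M]
  [MarkovCategory M]

/-- The causal model `F` over the DAG `G`, whose nodes are divided into endogenous nodes `V` and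
exogenous nodes `U`, is a causal model over the ADMG `L`. -/
def IsOverADMG {G : DAG (V ⊕ U)} (_F : CausalModel G M) (L : ADMG V) : Prop :=
  G.Represents L

/-- The restriction of the causal model `F` along a Markov functor `ι`. -/
def restrict {G : DAG V} {H : DAG W} (F : CausalModel G M)
    (ι : MarkovFunctor (FreeMarkov H) (FreeMarkov G)) : CausalModel H M :=
  ι.comp F

end CausalModel

/-! The proof rests on two facts: interventional morphisms are rigid, and the clusters of an
abstraction extend to disjoint territories.

Rigidity: an interventional morphism is determined by its domain and codomain
(`IsInterventional.unique`). Generate all nodes outside `X` in topological order and marginalize to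
`Y`. Every interventional diagram `X → Y` equals this canonical morphism, because a box whose output
has not been used yet can be absorbed into the joint distribution: given nodes closed under parents,
a node depends only on its own parents (`sample_comp_gen`, extended to whole diagrams by
`sample_comp_homMk`). Injectivity of the embedding on interventional morphisms is then automatic.

Territories: it remains to send each box of `H'` to a diagram of `L'` so that diagrams of different
boxes share no box. Assign to each node `w` a set of nodes containing its cluster, disjoint from the
other such sets, and with all outside parents in clusters of parents of `w`. The box of `w` becomes
a diagram generating its cluster inside its territory (`HasTerritories.exists_markovFunctor`). Under
merging, territories are united. Under deletion, the territory of the deleted node passes to its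
only child, if there is one; this is where the deletion condition is needed
(`AbstractsTo.exists_territories`).

If `L'` itself is abstracted, this finishes the proof. Otherwise territories must be moved from the
given DAG `L₁` to `L'`, which has the same latent projection but other exogenous nodes
(`exists_hasTerritories`). Endogenous parts of territories are kept. A common exogenous parent in
`L'` of nodes in two territories gives a bidirected edge of `L`, hence a common exogenous parent in
`L₁`, hence a common parent in `H₁`. This controls which exogenous nodes of `L'` may be absorbed
into territories and which must remain as nodes of `H'`. -/

/-! ### Pairing of morphisms in a Markov category -/

namespace CategoryTheory.MarkovCategory

variable {C : Type u₁} [Category.{v₁} C] [MonoidalCategory.{v₁} C] [MarkovCategory C]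

/-- The morphism that copies its input and applies `f` and `g` to the two copies. -/
def pair {X Y Z : C} (f : X ⟶ Y) (g : X ⟶ Z) : X ⟶ Y ⊗ Z := Δ[X] ≫ (f ⊗ₘ g)

/-- Discarding the second factor. -/
def fst (X Y : C) : X ⊗ Y ⟶ X := X ◁ ε[Y] ≫ (ρ_ X).hom

/-- Discarding the first factor. -/
def snd (X Y : C) : X ⊗ Y ⟶ Y := ε[X] ▷ Y ≫ (λ_ Y).hom

variable {W X Y Z A B D : C}

theorem pair_comp_tensorHom (f : X ⟶ Y) (g : X ⟶ Z) (h : Y ⟶ A) (k : Z ⟶ B) :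
    pair f g ≫ (h ⊗ₘ k) = pair (f ≫ h) (g ≫ k) := by
  simp [pair]

theorem pair_comp_tensorHom_assoc (f : X ⟶ Y) (g : X ⟶ Z) (h : Y ⟶ A) (k : Z ⟶ B)
    (q : A ⊗ B ⟶ D) : pair f g ≫ (h ⊗ₘ k) ≫ q = pair (f ≫ h) (g ≫ k) ≫ q := by
  rw [← Category.assoc, pair_comp_tensorHom]

theorem pair_comp_whiskerLeft (f : X ⟶ Y) (g : X ⟶ Z) (k : Z ⟶ B) :
    pair f g ≫ Y ◁ k = pair f (g ≫ k) := by
  rw [← id_tensorHom, pair_comp_tensorHom, Category.comp_id]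

theorem pair_comp_whiskerLeft_assoc (f : X ⟶ Y) (g : X ⟶ Z) (k : Z ⟶ B)
    (q : Y ⊗ B ⟶ D) : pair f g ≫ Y ◁ k ≫ q = pair f (g ≫ k) ≫ q := by
  rw [← Category.assoc, pair_comp_whiskerLeft]

theorem pair_comp_whiskerRight (f : X ⟶ Y) (g : X ⟶ Z) (h : Y ⟶ A) :
    pair f g ≫ h ▷ Z = pair (f ≫ h) g := by
  rw [← tensorHom_id, pair_comp_tensorHom, Category.comp_id]

theorem pair_comp_whiskerRight_assoc (f : X ⟶ Y) (g : X ⟶ Z) (h : Y ⟶ A)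
    (q : A ⊗ Z ⟶ D) : pair f g ≫ h ▷ Z ≫ q = pair (f ≫ h) g ≫ q := by
  rw [← Category.assoc, pair_comp_whiskerRight]

/-- `p` is deterministic: applying `p` and copying the result is the same as copying the input and
applying `p` to both copies. -/
def IsDet (p : W ⟶ X) : Prop := p ≫ pair (𝟙 X) (𝟙 X) = pair p p

/-- Pairing is copying followed by a tensor product, and only a deterministic `p` may be moved past
the copy. In general the left side shares one random value between the branches, while the right
side draws two. -/
theorem IsDet.comp_pair {p : W ⟶ X} (hp : IsDet p) (f : X ⟶ Y) (g : X ⟶ Z) :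
    p ≫ pair f g = pair (p ≫ f) (p ≫ g) := by
  have h : pair f g = pair (𝟙 X) (𝟙 X) ≫ (f ⊗ₘ g) := by simp [pair_comp_tensorHom]
  rw [h, ← Category.assoc, hp, pair_comp_tensorHom]

theorem IsDet.id (X : C) : IsDet (𝟙 X) := by simp [IsDet]

theorem IsDet.comp {p : W ⟶ X} {q : X ⟶ Y} (hp : IsDet p) (hq : IsDet q) : IsDet (p ≫ q) := by
  rw [IsDet, Category.assoc, hq, hp.comp_pair]

theorem pair_comp_fst (f : X ⟶ Y) (g : X ⟶ Z) : pair f g ≫ fst Y Z = f := by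
  rw [fst, pair_comp_whiskerLeft_assoc, MarkovCategory.discard_natural, pair]
  simp

theorem pair_comp_fst_assoc (f : X ⟶ Y) (g : X ⟶ Z)
    (q : Y ⟶ D) : pair f g ≫ fst Y Z ≫ q = f ≫ q := by
  rw [← Category.assoc, pair_comp_fst]

theorem pair_comp_snd (f : X ⟶ Y) (g : X ⟶ Z) : pair f g ≫ snd Y Z = g := by
  rw [snd, pair_comp_whiskerRight_assoc, MarkovCategory.discard_natural, pair]
  simp

theorem pair_comp_snd_assoc (f : X ⟶ Y) (g : X ⟶ Z)
    (q : Z ⟶ D) : pair f g ≫ snd Y Z ≫ q = g ≫ q := by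
  rw [← Category.assoc, pair_comp_snd]

theorem pair_discard_comp_leftUnitor (g : X ⟶ Z) : pair ε[X] g ≫ (λ_ Z).hom = g := by
  rw [pair]; simp

theorem pair_discard_comp_rightUnitor (g : X ⟶ Z) : pair g ε[X] ≫ (ρ_ Z).hom = g := by
  rw [pair]; simp

theorem pair_comp_braiding (f : X ⟶ Y) (g : X ⟶ Z) : pair f g ≫ (β_ Y Z).hom = pair g f := by
  rw [pair, pair, Category.assoc, BraidedCategory.braiding_naturality,
    IsCommComonObj.comul_comm_assoc]

theorem pair_pair_comp_associator (f : X ⟶ Y) (g : X ⟶ Z) (h : X ⟶ A) :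
    pair (pair f g) h ≫ (α_ Y Z A).hom = pair f (pair g h) := by
  have h₁ : pair (pair f g) h = Δ[X] ≫ Δ[X] ▷ X ≫ ((f ⊗ₘ g) ⊗ₘ h) := by
    rw [pair, pair, ← tensorHom_id, tensorHom_comp_tensorHom, Category.id_comp]
  have h₂ : pair f (pair g h) = Δ[X] ≫ X ◁ Δ[X] ≫ (f ⊗ₘ g ⊗ₘ h) := by
    rw [pair, pair, ← id_tensorHom, tensorHom_comp_tensorHom, Category.id_comp]
  rw [h₁, h₂]
  simp only [Category.assoc, associator_naturality]
  rw [comul_assoc_assoc]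

theorem pair_pair_comp_associator_assoc (f : X ⟶ Y) (g : X ⟶ Z) (h : X ⟶ A)
    (q : Y ⊗ (Z ⊗ A) ⟶ D) : pair (pair f g) h ≫ (α_ Y Z A).hom ≫ q = pair f (pair g h) ≫ q := by
  rw [← Category.assoc, pair_pair_comp_associator]

theorem pair_pair_comp_associator_inv (f : X ⟶ Y) (g : X ⟶ Z) (h : X ⟶ A) :
    pair f (pair g h) ≫ (α_ Y Z A).inv = pair (pair f g) h := by
  rw [← pair_pair_comp_associator, Category.assoc, Iso.hom_inv_id, Category.comp_id]

theorem pair_pair_comp_tensorμ (f : X ⟶ Y) (g : X ⟶ Z) (h : X ⟶ A) (k : X ⟶ B) :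
    pair (pair f g) (pair h k) ≫ tensorμ Y Z A B = pair (pair f h) (pair g k) := by
  rw [tensorμ, pair_pair_comp_associator_assoc, pair_comp_whiskerLeft_assoc,
    pair_pair_comp_associator_inv, pair_comp_whiskerLeft_assoc, pair_comp_whiskerRight,
    pair_comp_braiding, pair_comp_whiskerLeft_assoc, pair_pair_comp_associator,
    pair_pair_comp_associator_inv]

theorem pair_id_id_tensor (X Y : C) :
    pair (𝟙 (X ⊗ Y)) (𝟙 (X ⊗ Y)) =
      (pair (𝟙 X) (𝟙 X) ⊗ₘ pair (𝟙 Y) (𝟙 Y)) ≫ tensorμ X X Y Y := by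
  simp only [pair, id_tensorHom_id, Category.comp_id]
  exact CopyDiscardCategory.copy_tensor X Y

theorem IsDet.pair {f : X ⟶ Y} {g : X ⟶ Z} (hf : IsDet f) (hg : IsDet g) :
    IsDet (pair f g) := by
  rw [IsDet, pair_id_id_tensor, pair_comp_tensorHom_assoc, hf, hg, pair_pair_comp_tensorμ]

theorem IsDet.discard (X : C) : IsDet ε[X] := by
  have h : MarkovCategory.pair (𝟙 (𝟙_ C)) (𝟙 (𝟙_ C)) = (λ_ (𝟙_ C)).inv := by
    rw [MarkovCategory.pair, id_tensorHom_id, Category.comp_id]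
    exact CopyDiscardCategory.copy_unit
  rw [IsDet, h, MarkovCategory.pair]
  simp [unitors_inv_equal]

/-- Copying a tensor product copies each factor, and the counit laws remove the superfluous copies.
What remains of the middle interchange is the braiding of the unit with itself, which is trivial. -/
theorem pair_fst_snd (X Y : C) : pair (fst X Y) (snd X Y) = 𝟙 (X ⊗ Y) := by
  have h : pair (fst X Y) (snd X Y) = pair (𝟙 (X ⊗ Y)) (𝟙 (X ⊗ Y)) ≫ (fst X Y ⊗ₘ snd X Y) := by
    simp [pair_comp_tensorHom]
  have hX : pair (𝟙 X) (𝟙 X) ≫ (𝟙 X ⊗ₘ ε[X]) = (ρ_ X).inv := by simp [pair]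
  have hY : pair (𝟙 Y) (𝟙 Y) ≫ (ε[Y] ⊗ₘ 𝟙 Y) = (λ_ Y).inv := by simp [pair]
  rw [h, fst, snd, ← tensorHom_comp_tensorHom, ← id_tensorHom, ← tensorHom_id, pair_id_id_tensor,
    Category.assoc, ← tensorμ_natural_assoc, tensorHom_comp_tensorHom_assoc, hX, hY, tensorμ]
  have hb : (β_ (𝟙_ C) (𝟙_ C)).hom = 𝟙 _ := by
    simp [unitors_inv_equal]
  rw [hb]
  monoidal

theorem pair_fst_comp_snd_comp (f : X ⟶ Z) (g : Y ⟶ W) :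
    pair (fst X Y ≫ f) (snd X Y ≫ g) = f ⊗ₘ g := by
  rw [← pair_comp_tensorHom, pair_fst_snd, Category.id_comp]

theorem IsDet.tensorHom {f : X ⟶ Y} {g : Z ⟶ W} (hf : IsDet f) (hg : IsDet g) :
    IsDet (f ⊗ₘ g) := by
  have h : MarkovCategory.pair (f ⊗ₘ g) (f ⊗ₘ g) =
      MarkovCategory.pair (𝟙 (X ⊗ Z)) (𝟙 (X ⊗ Z)) ≫ ((f ⊗ₘ g) ⊗ₘ (f ⊗ₘ g)) := by
    rw [pair_comp_tensorHom, Category.id_comp]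
  rw [IsDet, h, pair_id_id_tensor, pair_id_id_tensor, Category.assoc, ← tensorμ_natural,
    tensorHom_comp_tensorHom_assoc, tensorHom_comp_tensorHom_assoc, pair_comp_tensorHom,
    pair_comp_tensorHom, hf, hg]
  simp

/-- Used for the unitors: their inverses are pairings of an identity with a discard, so determinism
is visible there first. -/
theorem IsDet.of_inv (e : X ≅ Y) (h : IsDet e.inv) : IsDet e.hom := by
  rw [IsDet, ← cancel_epi e.inv, h.comp_pair]
  simp

theorem IsDet.leftUnitor (X : C) : IsDet (λ_ X).hom := by
  refine .of_inv _ ?_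
  have h : (λ_ X).inv = MarkovCategory.pair ε[X] (𝟙 X) := by simp [MarkovCategory.pair]
  rw [h]
  exact (IsDet.discard X).pair (.id X)

theorem IsDet.rightUnitor (X : C) : IsDet (ρ_ X).hom := by
  refine .of_inv _ ?_
  have h : (ρ_ X).inv = MarkovCategory.pair (𝟙 X) ε[X] := by simp [MarkovCategory.pair]
  rw [h]
  exact (IsDet.id X).pair (.discard X)

theorem IsDet.fst (X Y : C) : IsDet (fst X Y) := by
  rw [MarkovCategory.fst, ← id_tensorHom]
  exact ((IsDet.id X).tensorHom (.discard Y)).comp (.rightUnitor X)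

theorem IsDet.snd (X Y : C) : IsDet (snd X Y) := by
  rw [MarkovCategory.snd, ← tensorHom_id]
  exact ((IsDet.discard X).tensorHom (.id Y)).comp (.leftUnitor Y)

end CategoryTheory.MarkovCategory

/-! ### Selecting wires and generating nodes -/

namespace FreeMarkov

open MarkovCategory

variable {V : Type u} {G : DAG V}

theorem nodes_tensorList (l : List V) : (tensorList G l).nodes = l := by
  induction l with
  | nil => rfl
  | cons v l ih => simp [tensorList, nodes, ih]

@[simp] theorem mem_nodes_of {v w : V} : v ∈ (of w : FreeMarkov G).nodes ↔ v = w :=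
  List.mem_singleton

@[simp] theorem mem_nodes_tensor {v : V} {X Y : FreeMarkov G} :
    v ∈ (tensor X Y).nodes ↔ v ∈ X.nodes ∨ v ∈ Y.nodes := List.mem_append

@[simp] theorem mem_nodes_tensorObj {v : V} {X Y : FreeMarkov G} :
    v ∈ (X ⊗ Y : FreeMarkov G).nodes ↔ v ∈ X.nodes ∨ v ∈ Y.nodes := List.mem_append

theorem notMem_nodes_unit {v : V} : v ∉ (unit : FreeMarkov G).nodes := List.not_mem_nil

/-- The object of parents of a node. -/
noncomputable abbrev paObj (G : DAG V) (a : V) : FreeMarkov G := tensorList G (G.pa a).toList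

@[simp] theorem mem_nodes_paObj {v a : V} : v ∈ (paObj G a).nodes ↔ v ∈ G.pa a := by
  simp [nodes_tensorList]

namespace Diagram

open Classical in
/-- The diagram that selects the leftmost occurrence of the node `v`. -/
noncomputable def pick (v : V) : (S : FreeMarkov G) → v ∈ S.nodes → Diagram G S (of v)
  | of _, h => (mem_nodes_of.1 h) ▸ id (of v)
  | unit, h => (notMem_nodes_unit h).elim
  | tensor S T, h =>
    if hS : v ∈ S.nodes then ((discard T).whiskerLeft S).comp ((rightUnit S).comp (pick v S hS))
    else ((discard S).whiskerRight T).comp ((leftUnit T).comp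
      (pick v T ((mem_nodes_tensor.1 h).resolve_left hS)))

/-- The diagram without boxes that selects the nodes occurring in `Y` among those of `S`. -/
noncomputable def proj (S : FreeMarkov G) :
    (Y : FreeMarkov G) → (∀ v ∈ Y.nodes, v ∈ S.nodes) → Diagram G S Y
  | of v, h => pick v S (h v (mem_nodes_of.2 rfl))
  | unit, _ => discard S
  | tensor Y Z, h => (copy S).comp
      (((proj S Y fun v hv => h v (mem_nodes_tensor.2 (.inl hv))).whiskerRight S).comp
        ((proj S Z fun v hv => h v (mem_nodes_tensor.2 (.inr hv))).whiskerLeft Y))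

theorem boxes_pick (v : V) (S : FreeMarkov G) (h : v ∈ S.nodes) : (pick v S h).boxes = [] := by
  induction S with
  | of w => obtain rfl := mem_nodes_of.1 h; rfl
  | unit => exact (notMem_nodes_unit h).elim
  | tensor S T ihS ihT =>
    rw [pick]
    split <;> simp [boxes, ihS, ihT]

theorem boxes_proj (S Y : FreeMarkov G) (h) : (proj S Y h).boxes = [] := by
  induction Y with
  | of v => exact boxes_pick _ _ _
  | unit => rfl
  | tensor Y Z ihY ihZ => simp [proj, boxes, ihY, ihZ]

/-- The object obtained from `X` by adding wires for the nodes in `t`, the last one first. -/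
def extend (X : FreeMarkov G) : List V → FreeMarkov G
  | [] => X
  | b :: t => tensor (extend X t) (of b)

@[simp] theorem mem_nodes_extend {v : V} {X : FreeMarkov G} {t : List V} :
    v ∈ (extend X t).nodes ↔ v ∈ X.nodes ∨ v ∈ t := by
  induction t with
  | nil => simp [extend]
  | cons b t ih => simp [extend, ih]; tauto

/-- The nodes in `t` can be generated from `X`, the last one first. -/
def Generates (X : FreeMarkov G) : List V → Prop
  | [] => True
  | b :: t => (∀ p ∈ G.pa b, p ∈ X.nodes ∨ p ∈ t) ∧ Generates X t

/-- The diagram that generates the nodes in `t` from `X`, the last one first. -/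
noncomputable def run (X : FreeMarkov G) :
    (t : List V) → Generates X t → Diagram G X (extend X t)
  | [], _ => id X
  | b :: t, h => (run X t h.2).comp ((copy (extend X t)).comp
      (((proj (extend X t) (paObj G b)
        fun p hp => mem_nodes_extend.2 (h.1 p (mem_nodes_paObj.1 hp))).comp (box b)).whiskerLeft
          (extend X t)))

theorem boxes_run (X : FreeMarkov G) (t : List V) (h : Generates X t) :
    (run X t h).boxes = t.reverse := by
  induction t with
  | nil => rfl
  | cons b t ih => simp [run, boxes, ih, boxes_proj]

theorem Generates.pa_subset {X : FreeMarkov G} {t : List V} (h : Generates X t) {a : V}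
    (ha : a ∈ t) : ∀ p ∈ G.pa a, p ∈ X.nodes ∨ p ∈ t := by
  induction t with
  | nil => simp at ha
  | cons b t ih =>
    rcases List.mem_cons.1 ha with rfl | ha
    · exact fun p hp => (h.1 p hp).imp_right (List.mem_cons_of_mem _)
    · exact fun p hp => (ih h.2 ha p hp).imp_right (List.mem_cons_of_mem _)

end Diagram

open Diagram

/-! ### Calculus of selections -/

/-- The morphism that selects the nodes occurring in `Y` among those of `S`. -/
noncomputable def select (S Y : FreeMarkov G) (h : ∀ v ∈ Y.nodes, v ∈ S.nodes) : S ⟶ Y :=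
  homMk (proj S Y h)

variable {S T X Y Z : FreeMarkov G}

theorem select_tensor (h : ∀ v ∈ (Y ⊗ Z : FreeMarkov G).nodes, v ∈ S.nodes) :
    select S (Y ⊗ Z) h = pair (select S Y fun v hv => h v (mem_nodes_tensor.2 (.inl hv)))
      (select S Z fun v hv => h v (mem_nodes_tensor.2 (.inr hv))) := rfl

theorem select_of_of (v : V) (h) : select (of v : FreeMarkov G) (of v) h = 𝟙 (of v) := rfl

theorem select_tensor_of_left {v : V} (h : v ∈ S.nodes) (h') :
    select (S ⊗ T) (of v) h' = fst S T ≫ select S (of v) (by simpa) := by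
  have := Category.assoc (S ◁ ε[T]) (ρ_ S).hom (select S (of v) (by simpa))
  refine Eq.trans ?_ this.symm
  change homMk (pick v (tensor S T) _) = _
  rw [pick, dif_pos h]
  rfl

theorem select_tensor_of_right {v : V} (h : v ∉ S.nodes) (hT : v ∈ T.nodes) (h') :
    select (S ⊗ T) (of v) h' = snd S T ≫ select T (of v) (by simpa) := by
  have := Category.assoc (ε[S] ▷ T) (λ_ T).hom (select T (of v) (by simpa))
  refine Eq.trans ?_ this.symm
  change homMk (pick v (tensor S T) _) = _
  rw [pick, dif_neg h]
  rfl

theorem select_of_isDet (v : V) (h) : IsDet (select S (of v) h) := by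
  induction S with
  | of w => obtain rfl := mem_nodes_of.1 (h v (mem_nodes_of.2 rfl)); exact IsDet.id _
  | unit => exact (notMem_nodes_unit (h v (mem_nodes_of.2 rfl))).elim
  | tensor S T ihS ihT =>
    by_cases hS : v ∈ S.nodes
    · exact (select_tensor_of_left (T := T) hS h) ▸ (IsDet.fst S T).comp (ihS _)
    · have hT := (mem_nodes_tensor.1 (h v (mem_nodes_of.2 rfl))).resolve_left hS
      exact (select_tensor_of_right hS hT h) ▸ (IsDet.snd S T).comp (ihT _)

theorem isDet_select (S Y : FreeMarkov G) (h) : IsDet (select S Y h) := by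
  induction Y with
  | of v => exact select_of_isDet v h
  | unit => exact IsDet.discard S
  | tensor Y Z ihY ihZ => exact (ihY _).pair (ihZ _)

/-- No assumption on repeated nodes is needed: all wires `v` of `T` are copies of the same wire of
`S`, its leftmost `v`, so it does not matter which of them is selected. -/
theorem select_comp_select_of (v : V) (hT : ∀ v ∈ T.nodes, v ∈ S.nodes) (h) (h') :
    select S T hT ≫ select T (of v) h = select S (of v) h' := by
  induction T with
  | of w =>
    obtain rfl := mem_nodes_of.1 (h v (mem_nodes_of.2 rfl)); exact Category.comp_id _
  | unit => exact (notMem_nodes_unit (h v (mem_nodes_of.2 rfl))).elim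
  | tensor T T' ih ih' =>
    have e : select S (tensor T T') hT = _ := select_tensor (S := S) (Y := T) (Z := T') hT
    by_cases hv : v ∈ T.nodes
    · have e' : select (tensor T T') (of v) h = _ := select_tensor_of_left (T := T') hv h
      rw [e, e']
      exact (pair_comp_fst_assoc _ _ _).trans (ih _ _)
    · have hv' := (mem_nodes_tensor.1 (h v (mem_nodes_of.2 rfl))).resolve_left hv
      have e' : select (tensor T T') (of v) h = _ := select_tensor_of_right hv hv' h
      rw [e, e']
      exact (pair_comp_snd_assoc _ _ _).trans (ih' _ _)

theorem select_comp_select (hT : ∀ v ∈ T.nodes, v ∈ S.nodes) (hY : ∀ v ∈ Y.nodes, v ∈ T.nodes) :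
    select S T hT ≫ select T Y hY = select S Y fun v hv => hT v (hY v hv) := by
  induction Y with
  | of v => exact select_comp_select_of v _ _ _
  | unit => exact MarkovCategory.discard_natural _
  | tensor Y Z ihY ihZ =>
    change _ ≫ select T (Y ⊗ Z) hY = select S (Y ⊗ Z) _
    rw [select_tensor, select_tensor, (isDet_select S T hT).comp_pair, ihY, ihZ]

theorem select_tensor_left (hY : ∀ v ∈ Y.nodes, v ∈ S.nodes) (h) :
    select (S ⊗ T) Y h = fst S T ≫ select S Y hY := by
  induction Y with
  | of v => exact select_tensor_of_left (hY v (mem_nodes_of.2 rfl)) h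
  | unit => exact (MarkovCategory.discard_natural (fst S T)).symm
  | tensor Y Z ihY ihZ =>
    change select (S ⊗ T) (Y ⊗ Z) h = _ ≫ select S (Y ⊗ Z) hY
    rw [select_tensor, select_tensor, (IsDet.fst S T).comp_pair, ihY,
      ihZ (fun v hv => hY v (mem_nodes_tensor.2 (.inr hv)))]

theorem select_tensor_right (hY : ∀ v ∈ Y.nodes, v ∈ T.nodes) (hS : ∀ v ∈ Y.nodes, v ∉ S.nodes) (h) :
    select (S ⊗ T) Y h = snd S T ≫ select T Y hY := by
  induction Y with
  | of v => exact select_tensor_of_right (hS v (mem_nodes_of.2 rfl)) (hY v (mem_nodes_of.2 rfl)) h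
  | unit => exact (MarkovCategory.discard_natural (snd S T)).symm
  | tensor Y Z ihY ihZ =>
    change select (S ⊗ T) (Y ⊗ Z) h = _ ≫ select T (Y ⊗ Z) hY
    rw [select_tensor, select_tensor, (IsDet.snd S T).comp_pair,
      ihY (fun v hv => hY v (mem_nodes_tensor.2 (.inl hv)))
        (fun v hv => hS v (mem_nodes_tensor.2 (.inl hv))),
      ihZ (fun v hv => hY v (mem_nodes_tensor.2 (.inr hv)))
        (fun v hv => hS v (mem_nodes_tensor.2 (.inr hv)))]

/-- With a repeated node the selection would duplicate its leftmost wire and forget the others, so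
distinctness is essential. -/
theorem select_self (hS : S.nodes.Nodup) (h) : select S S h = 𝟙 S := by
  induction S with
  | of v => rfl
  | unit => exact CopyDiscardCategory.discard_unit (C := FreeMarkov G)
  | tensor S T ihS ihT =>
    obtain ⟨h₁, h₂, h₃⟩ := List.nodup_append.1 hS
    refine (select_tensor (S := S ⊗ T) (Y := S) (Z := T) h).trans ?_
    rw [select_tensor_left (fun _ h => h), ihS h₁, select_tensor_right (fun _ h => h), ihT h₂,
      Category.comp_id, Category.comp_id, pair_fst_snd]
    · rfl
    · exact fun v hv hv' => h₃ v hv' v hv rfl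

end FreeMarkov

/-! ### Uniqueness of interventional morphisms -/

namespace FreeMarkov

open MarkovCategory Diagram

variable {V : Type u} {G : DAG V} {X Y Z A B : FreeMarkov G} {t : List V}

/-- Generate the nodes in `t` from `X` and marginalize to `Y`. -/
noncomputable def sample (X : FreeMarkov G) (t : List V) (h : Generates X t) (Y : FreeMarkov G)
    (hY : ∀ v ∈ Y.nodes, v ∈ X.nodes ∨ v ∈ t) : X ⟶ Y :=
  homMk (run X t h) ≫ select (extend X t) Y fun v hv => mem_nodes_extend.2 (hY v hv)

/-- The generating morphism of the node `a`. -/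
noncomputable def gen (G : DAG V) (a : V) : paObj G a ⟶ of a := homMk (box a)

theorem sample_tensor_comp_whiskerRight_select (h : Generates X t) (hYA)
    (hZ : ∀ v ∈ Z.nodes, v ∈ Y.nodes) (hZA) :
    sample X t h (Y ⊗ A) hYA ≫ select Y Z hZ ▷ A = sample X t h (Z ⊗ A) hZA := by
  rw [sample, Category.assoc, select_tensor, pair_comp_whiskerRight, select_comp_select, sample,
    select_tensor]

theorem sample_tensor_tensor_comp (h : Generates X t) (hl) (hr) :
    sample X t h ((A ⊗ B) ⊗ Y) hl ≫ (α_ A B Y).hom ≫ A ◁ (β_ B Y).hom ≫ (α_ A Y B).inv =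
      sample X t h ((A ⊗ Y) ⊗ B) hr := by
  simp only [sample, Category.assoc, select_tensor, pair_pair_comp_associator_assoc,
    pair_comp_whiskerLeft_assoc, pair_comp_braiding, pair_pair_comp_associator_inv]

theorem Diagram.Generates.head {b : V} (h : Generates X (b :: t)) :
    ∀ v ∈ (paObj G b).nodes, v ∈ (extend X t).nodes :=
  fun v hv => mem_nodes_extend.2 (h.1 v (mem_nodes_paObj.1 hv))

theorem Diagram.Generates.tail {b : V} (h : Generates X (b :: t)) : Generates X t := h.2

theorem sample_cons (b : V) (h : Generates X (b :: t)) (hY)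
    (hY' : ∀ v ∈ Y.nodes, v ∈ (extend X t ⊗ of b : FreeMarkov G).nodes) :
    sample X (b :: t) h Y hY = homMk (run X t h.tail) ≫
      pair (𝟙 _) (select (extend X t) (paObj G b) h.head ≫ gen G b) ≫
        select (extend X t ⊗ of b) Y hY' := by
  rw [pair, id_tensorHom]
  refine Eq.trans ?_ (Category.assoc _ _ _)
  rfl

/-- The last generated node is discarded, and discarding absorbs its box because the unit is
terminal. -/
theorem sample_cons_of_subset (b : V) (h : Generates X (b :: t))
    (hY : ∀ v ∈ Y.nodes, v ∈ X.nodes ∨ v ∈ t) (hY') :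
    sample X (b :: t) h Y hY' = sample X t h.tail Y hY := by
  have hY'' : ∀ v ∈ Y.nodes, v ∈ (extend X t).nodes := fun v hv => mem_nodes_extend.2 (hY v hv)
  rw [sample_cons b h hY' fun v hv => mem_nodes_tensorObj.2 (.inl (hY'' v hv)),
    select_tensor_left hY'', pair_comp_fst_assoc, Category.id_comp, sample]

/-- Since `b` is neither an input nor generated earlier, the selected wire `b` is the output of the
last box. That box can therefore be moved behind the marginalization. -/
theorem sample_cons_tensor (b : V) (h : Generates X (b :: t)) (hbX : b ∉ X.nodes) (hbt : b ∉ t)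
    (hY : ∀ v ∈ Y.nodes, v ∈ X.nodes ∨ v ∈ t) (hYp) (hYb) :
    sample X (b :: t) h (Y ⊗ of b) hYb =
      sample X t h.tail (Y ⊗ paObj G b) hYp ≫ Y ◁ gen G b := by
  have hY' : ∀ v ∈ Y.nodes, v ∈ (extend X t).nodes := fun v hv => mem_nodes_extend.2 (hY v hv)
  have hYb' : ∀ v ∈ (Y ⊗ of b : FreeMarkov G).nodes,
      v ∈ (extend X t ⊗ of b : FreeMarkov G).nodes := by
    intro v hv
    exact mem_nodes_tensorObj.2 ((mem_nodes_tensorObj.1 hv).imp_left (hY' v))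
  rw [sample_cons b h hYb hYb', sample, Category.assoc]
  congr 1
  rw [select_tensor, select_tensor, pair_comp_whiskerLeft,
    select_tensor_left hY',
    select_tensor_right (fun _ h => h), select_of_of, pair_fst_comp_snd_comp,
    pair_comp_tensorHom, Category.id_comp, Category.comp_id]
  intro v hv
  rw [mem_nodes_of.1 hv, mem_nodes_extend]
  tauto

theorem sample_cons_tensor_tensor (b : V) (h : Generates X (b :: t)) (hbX : b ∉ X.nodes)
    (hbt : b ∉ t) (hYZ : ∀ v ∈ (Y ⊗ Z : FreeMarkov G).nodes, v ∈ X.nodes ∨ v ∈ t) (hp) (hb) :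
    sample X (b :: t) h ((Y ⊗ of b) ⊗ Z) hb =
      sample X t h.tail ((Y ⊗ paObj G b) ⊗ Z) hp ≫ (Y ◁ gen G b) ▷ Z := by
  have hb' : ∀ v ∈ ((Y ⊗ Z) ⊗ of b : FreeMarkov G).nodes, v ∈ X.nodes ∨ v ∈ b :: t := by
    simpa [or_imp, forall_and, and_assoc, and_comm, and_left_comm] using hb
  have hp' : ∀ v ∈ ((Y ⊗ Z) ⊗ paObj G b : FreeMarkov G).nodes, v ∈ X.nodes ∨ v ∈ t := by
    simpa [or_imp, forall_and, and_assoc, and_comm, and_left_comm] using hp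
  rw [← sample_tensor_tensor_comp h hb' hb, sample_cons_tensor b h hbX hbt hYZ hp' hb',
    ← sample_tensor_tensor_comp h.tail hp' hp]
  simp only [Category.assoc, whisker_assoc, tensor_whiskerLeft, Iso.inv_hom_id_assoc,
    ← whiskerLeft_comp_assoc, BraidedCategory.braiding_naturality_right]

/-- In the joint distribution generated by `t`, the node `a` depends on a set of nodes closed under
taking parents and not containing `a` only through the parents of `a`. -/
theorem sample_comp_gen (h : Generates X t) (hX : ∀ v ∈ t, v ∉ X.nodes) (ht : t.Nodup)
    {P : Set V} (hP : ∀ c ∈ P, c ∉ X.nodes → ∀ p ∈ G.pa c, p ∈ P) {a : V} (hat : a ∈ t)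
    (haP : a ∉ P) (hpa : ∀ p ∈ G.pa a, p ∈ P) (hYP : ∀ v ∈ Y.nodes, v ∈ P)
    (hY : ∀ v ∈ Y.nodes, v ∈ X.nodes ∨ v ∈ t) (hl) (hr) :
    sample X t h (Y ⊗ paObj G a) hl ≫ Y ◁ gen G a = sample X t h (Y ⊗ of a) hr := by
  induction t generalizing Y with
  | nil => simp at hat
  | cons b t ih =>
    have hbX := hX b List.mem_cons_self
    obtain ⟨hbt, ht'⟩ := List.nodup_cons.1 ht
    have hX' : ∀ v ∈ t, v ∉ X.nodes := fun v hv => hX v (List.mem_cons_of_mem _ hv)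
    have drop : ∀ v, v ≠ b → v ∈ X.nodes ∨ v ∈ b :: t → v ∈ X.nodes ∨ v ∈ t := fun v hv h =>
      h.imp_right fun h => (List.mem_cons.1 h).resolve_left hv
    by_cases hab : a = b
    · subst hab
      -- The wires `Y` lie in `P`, which misses `a`, so the discarded first draw of `a` can be
      -- replaced by the second one.
      have hY' : ∀ v ∈ Y.nodes, v ∈ X.nodes ∨ v ∈ t := fun v hv =>
        drop v (by rintro rfl; exact haP (hYP _ hv)) (hY v hv)
      have hp : ∀ v ∈ (Y ⊗ paObj G a : FreeMarkov G).nodes, v ∈ X.nodes ∨ v ∈ t := by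
        intro v hv
        rcases mem_nodes_tensorObj.1 hv with hv | hv
        · exact hY' v hv
        · exact h.1 v (mem_nodes_paObj.1 hv)
      rw [sample_cons_tensor a h hbX hbt hY' hp hr, sample_cons_of_subset a h hp]
    · have hat' : a ∈ t := (List.mem_cons.1 hat).resolve_left hab
      have hpat : ∀ p ∈ G.pa a, p ∈ X.nodes ∨ p ∈ t := h.tail.pa_subset hat'
      by_cases hbY : b ∈ Y.nodes
      · classical
        -- The node `b` may occur in `Y` anywhere and several times. It suffices to treat `Y₀ ⊗ of
        -- b`, from which `Y` is recovered by a selection.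
        set Y₀ : FreeMarkov G := tensorList G (Y.nodes.filter (· ≠ b)) with hY₀
        have memY₀ : ∀ v, v ∈ Y₀.nodes ↔ v ∈ Y.nodes ∧ v ≠ b := fun v => by
          simp [hY₀, nodes_tensorList]
        have hY₀t : ∀ v ∈ Y₀.nodes, v ∈ X.nodes ∨ v ∈ t := fun v hv =>
          drop v ((memY₀ v).1 hv).2 (hY v ((memY₀ v).1 hv).1)
        have hYsub : ∀ v ∈ Y.nodes, v ∈ (Y₀ ⊗ of b : FreeMarkov G).nodes := fun v hv => by
          simp only [mem_nodes_tensorObj, memY₀, mem_nodes_of]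
          tauto
        have hD : ∀ v ∈ (Y₀ ⊗ paObj G b : FreeMarkov G).nodes, v ∈ P := by
          intro v hv
          rcases mem_nodes_tensorObj.1 hv with hv | hv
          · exact hYP v ((memY₀ v).1 hv).1
          · exact hP b (hYP b hbY) hbX v (mem_nodes_paObj.1 hv)
        have hDt : ∀ v ∈ (Y₀ ⊗ paObj G b : FreeMarkov G).nodes, v ∈ X.nodes ∨ v ∈ t := by
          intro v hv
          rcases mem_nodes_tensorObj.1 hv with hv | hv
          · exact hY₀t v hv
          · exact h.1 v (mem_nodes_paObj.1 hv)
        have h₁ : ∀ v ∈ ((Y₀ ⊗ paObj G b) ⊗ paObj G a : FreeMarkov G).nodes,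
            v ∈ X.nodes ∨ v ∈ t := by
          intro v hv
          rcases mem_nodes_tensorObj.1 hv with hv | hv
          · exact hDt v hv
          · exact hpat v (mem_nodes_paObj.1 hv)
        have h₂ : ∀ v ∈ ((Y₀ ⊗ paObj G b) ⊗ of a : FreeMarkov G).nodes,
            v ∈ X.nodes ∨ v ∈ t := by
          intro v hv
          rcases mem_nodes_tensorObj.1 hv with hv | hv
          · exact hDt v hv
          · rw [mem_nodes_of.1 hv]; exact .inr hat'
        have weaken : ∀ v, v ∈ X.nodes ∨ v ∈ t → v ∈ X.nodes ∨ v ∈ b :: t := fun v hv =>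
          hv.imp_right (List.mem_cons_of_mem _)
        have h₃ : ∀ v ∈ ((Y₀ ⊗ of b) ⊗ paObj G a : FreeMarkov G).nodes,
            v ∈ X.nodes ∨ v ∈ b :: t := by
          intro v hv
          rcases mem_nodes_tensorObj.1 hv with hv | hv
          · rcases mem_nodes_tensorObj.1 hv with hv | hv
            · exact weaken v (hY₀t v hv)
            · rw [mem_nodes_of.1 hv]; simp
          · exact weaken v (hpat v (mem_nodes_paObj.1 hv))
        have h₄ : ∀ v ∈ ((Y₀ ⊗ of b) ⊗ of a : FreeMarkov G).nodes,
            v ∈ X.nodes ∨ v ∈ b :: t := by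
          intro v hv
          rcases mem_nodes_tensorObj.1 hv with hv | hv
          · rcases mem_nodes_tensorObj.1 hv with hv | hv
            · exact weaken v (hY₀t v hv)
            · rw [mem_nodes_of.1 hv]; simp
          · rw [mem_nodes_of.1 hv]; exact .inr hat
        have h₅ : ∀ v ∈ (Y₀ ⊗ paObj G a : FreeMarkov G).nodes, v ∈ X.nodes ∨ v ∈ t := by
          intro v hv
          rcases mem_nodes_tensorObj.1 hv with hv | hv
          · exact hY₀t v hv
          · exact hpat v (mem_nodes_paObj.1 hv)
        have h₆ : ∀ v ∈ (Y₀ ⊗ of a : FreeMarkov G).nodes, v ∈ X.nodes ∨ v ∈ t := by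
          intro v hv
          rcases mem_nodes_tensorObj.1 hv with hv | hv
          · exact hY₀t v hv
          · rw [mem_nodes_of.1 hv]; exact .inr hat'
        -- The box of `b` is pulled out to the end on both sides. It acts on other wires than the
        -- box of `a`, so the two commute, and the induction hypothesis applies with `Y₀ ⊗ paObj G
        -- b` in place of `Y`. Closure of `P` under parents keeps these wires in `P`.
        rw [← sample_tensor_comp_whiskerRight_select h h₃ hYsub,
          ← sample_tensor_comp_whiskerRight_select h h₄ hYsub, Category.assoc, ← whisker_exchange,
          sample_cons_tensor_tensor b h hbX hbt h₅ h₁ h₃,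
          sample_cons_tensor_tensor b h hbX hbt h₆ h₂ h₄,
          ← ih h.tail hX' ht' hat' hD hDt h₁ h₂]
        simp only [Category.assoc, whisker_exchange_assoc]
      · have hY' : ∀ v ∈ Y.nodes, v ∈ X.nodes ∨ v ∈ t := fun v hv =>
          drop v (by rintro rfl; exact hbY hv) (hY v hv)
        have h₁ : ∀ v ∈ (Y ⊗ paObj G a : FreeMarkov G).nodes, v ∈ X.nodes ∨ v ∈ t := by
          intro v hv
          rcases mem_nodes_tensorObj.1 hv with hv | hv
          · exact hY' v hv
          · exact hpat v (mem_nodes_paObj.1 hv)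
        have h₂ : ∀ v ∈ (Y ⊗ of a : FreeMarkov G).nodes, v ∈ X.nodes ∨ v ∈ t := by
          intro v hv
          rcases mem_nodes_tensorObj.1 hv with hv | hv
          · exact hY' v hv
          · rw [mem_nodes_of.1 hv]; exact .inr hat'
        rw [sample_cons_of_subset b h h₁, sample_cons_of_subset b h h₂]
        exact ih h.tail hX' ht' hat' hYP hY' h₁ h₂

/-- The nodes of the codomain of a diagram are generated by it or occur in the domain. -/
theorem Diagram.mem_nodes_or_mem_boxes (d : Diagram G A B) :
    ∀ v ∈ B.nodes, v ∈ A.nodes ∨ v ∈ d.boxes := by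
  induction d with
  | box a => intro v hv; exact .inr hv
  | comp f g ihf ihg =>
    intro v hv
    simp only [boxes, List.mem_append]
    rcases ihg v hv with h | h
    · exact (ihf v h).imp_right .inl
    · exact .inr (.inr h)
  | whiskerLeft X f ih =>
    intro v hv
    have := ih v
    simp only [boxes, mem_nodes_tensor] at *
    tauto
  | whiskerRight f X ih =>
    intro v hv
    have := ih v
    simp only [boxes, mem_nodes_tensor] at *
    tauto
  | discard X => intro v hv; exact (notMem_nodes_unit hv).elim
  | leftUnitInv => intro v hv; exact .inl (by simpa [nodes] using hv)
  | leftUnit => intro v hv; exact .inl (by simpa [nodes] using hv)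
  | rightUnitInv => intro v hv; exact .inl (by simpa [nodes] using hv)
  | rightUnit => intro v hv; exact .inl (by simpa [nodes] using hv)
  | id => exact fun v hv => .inl hv
  | _ => intro v hv; exact .inl (by simp only [mem_nodes_tensor] at *; tauto)

/-- The nodes of a diagram together with a set of nodes closed under taking parents are again such
a set. -/
theorem Diagram.pa_subset_of_mem_boxes {P : Set V} (d : Diagram G A B)
    (hA : ∀ v ∈ A.nodes, v ∈ P) :
    ∀ c ∈ d.boxes, ∀ p ∈ G.pa c, p ∈ P ∨ p ∈ d.boxes := by
  induction d generalizing P with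
  | box a =>
    intro c hc p hp
    rw [List.mem_singleton.1 hc] at hp
    exact .inl (hA p (mem_nodes_paObj.2 hp))
  | comp f g ihf ihg =>
    intro c hc p hp
    simp only [boxes, List.mem_append] at hc ⊢
    rcases hc with hc | hc
    · exact (ihf hA c hc p hp).imp_right .inl
    · have := ihg (P := {v | v ∈ P ∨ v ∈ f.boxes})
        (fun v hv => (f.mem_nodes_or_mem_boxes v hv).imp_left (hA v)) c hc p hp
      simp only [Set.mem_ofPred_eq] at this
      tauto
  | whiskerLeft X f ih => exact ih fun v hv => hA v (mem_nodes_tensor.2 (.inr hv))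
  | whiskerRight f X ih => exact ih fun v hv => hA v (mem_nodes_tensor.2 (.inl hv))
  | _ => exact fun c hc => (List.not_mem_nil hc).elim

end FreeMarkov

/-! ### Absorbing string diagrams into the canonical joint distribution. -/

namespace FreeMarkov

open MarkovCategory Diagram

variable {V : Type u} {G : DAG V} {X Y Z A B : FreeMarkov G} {t : List V}

/-- A morphism into which every selection of wires is absorbed: this is the case for the structure
morphisms. -/
def IsStructural (f : A ⟶ B) : Prop :=
  ∀ (S : FreeMarkov G) (hA : ∀ v ∈ A.nodes, v ∈ S.nodes) (hB : ∀ v ∈ B.nodes, v ∈ S.nodes),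
    select S A hA ≫ f = select S B hB

theorem IsStructural.inv {e : A ≅ B} (h : IsStructural e.hom) :
    IsStructural e.inv := by
  intro S hB hA
  rw [Iso.comp_inv_eq, h S hA hB]

theorem isStructural_id (X : FreeMarkov G) : IsStructural (𝟙 X) := by
  intro S hA hB
  exact Category.comp_id _

theorem isStructural_associator (X Y Z : FreeMarkov G) : IsStructural (α_ X Y Z).hom := by
  intro S hA hB
  rw [select_tensor (Y := X ⊗ Y), select_tensor (Y := X), pair_pair_comp_associator]
  rfl

theorem isStructural_leftUnitor (X : FreeMarkov G) : IsStructural (λ_ X).hom := by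
  intro S hA hB
  exact pair_discard_comp_leftUnitor (select S X hB)

theorem isStructural_rightUnitor (X : FreeMarkov G) : IsStructural (ρ_ X).hom := by
  intro S hA hB
  exact pair_discard_comp_rightUnitor (select S X hB)

theorem isStructural_braiding (X Y : FreeMarkov G) : IsStructural (β_ X Y).hom := by
  intro S hA hB
  rw [select_tensor, pair_comp_braiding]
  rfl

/-- This is exactly the determinism of selections. -/
theorem isStructural_copy (X : FreeMarkov G) : IsStructural (homMk (copy X)) := by
  intro S hA hB
  have h : homMk (copy X) = pair (𝟙 X) (𝟙 X) := by
    rw [pair, id_tensorHom_id, Category.comp_id]; rfl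
  rw [h]
  exact isDet_select S X hA

theorem isStructural_discard (X : FreeMarkov G) : IsStructural (homMk (discard X)) := by
  intro S hA hB
  exact MarkovCategory.discard_natural _

theorem IsStructural.sample_comp_whiskerLeft {f : A ⟶ B} (hf : IsStructural f)
    (h : Generates X t) (hl : ∀ v ∈ (Y ⊗ A : FreeMarkov G).nodes, v ∈ X.nodes ∨ v ∈ t)
    (hr : ∀ v ∈ (Y ⊗ B : FreeMarkov G).nodes, v ∈ X.nodes ∨ v ∈ t) :
    sample X t h (Y ⊗ A) hl ≫ Y ◁ f = sample X t h (Y ⊗ B) hr := by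
  rw [sample, sample, Category.assoc, select_tensor, select_tensor, pair_comp_whiskerLeft,
    hf (extend X t) _ fun v hv => mem_nodes_extend.2 (hr v (mem_nodes_tensorObj.2 (.inr hv)))]

/-- Applying a string diagram none of whose boxes has been used so far to a distribution generated
by `t` amounts to generating its codomain by `t`. -/
theorem sample_comp_homMk (h : Generates X t) (hX : ∀ v ∈ t, v ∉ X.nodes) (ht : t.Nodup)
    (d : Diagram G A B) (hd : d.boxes.Nodup) (hdt : ∀ v ∈ d.boxes, v ∈ t) {P : Set V}
    (hP : ∀ c ∈ P, c ∉ X.nodes → ∀ p ∈ G.pa c, p ∈ P) (hdP : ∀ v ∈ d.boxes, v ∉ P)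
    (hAP : ∀ v ∈ A.nodes, v ∈ P) (hYP : ∀ v ∈ Y.nodes, v ∈ P)
    (hl : ∀ v ∈ (Y ⊗ A : FreeMarkov G).nodes, v ∈ X.nodes ∨ v ∈ t)
    (hr : ∀ v ∈ (Y ⊗ B : FreeMarkov G).nodes, v ∈ X.nodes ∨ v ∈ t) :
    sample X t h (Y ⊗ A) hl ≫ Y ◁ homMk d = sample X t h (Y ⊗ B) hr := by
  -- Wires running beside a whiskered diagram are moved into the passive factor `Y`; this is why the
  -- induction lets `Y` vary.
  have left : ∀ {Z A B : FreeMarkov G} (f : A ⟶ B) {Y : FreeMarkov G} (hl) (hr),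
      (∀ hl hr, sample X t h ((Y ⊗ Z) ⊗ A) hl ≫ (Y ⊗ Z) ◁ f = sample X t h ((Y ⊗ Z) ⊗ B) hr) →
      sample X t h (Y ⊗ (Z ⊗ A)) hl ≫ Y ◁ Z ◁ f = sample X t h (Y ⊗ (Z ⊗ B)) hr := by
    intro Z A B f Y hl hr hf
    have hl' : ∀ v ∈ ((Y ⊗ Z) ⊗ A : FreeMarkov G).nodes, v ∈ X.nodes ∨ v ∈ t := by
      simpa [or_assoc] using hl
    have hr' : ∀ v ∈ ((Y ⊗ Z) ⊗ B : FreeMarkov G).nodes, v ∈ X.nodes ∨ v ∈ t := by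
      simpa [or_assoc] using hr
    have e : ∀ (D : FreeMarkov G) (h₁) (h₂), sample X t h (Y ⊗ (Z ⊗ D)) h₁ =
        sample X t h ((Y ⊗ Z) ⊗ D) h₂ ≫ (α_ Y Z D).hom := by
      intro D h₁ h₂
      rw [sample, sample, Category.assoc, isStructural_associator Y Z D]
    rw [e A hl hl', e B hr hr', ← hf hl' hr']
    simp
  induction d generalizing Y P with
  | box a =>
    have ha : a ∈ t := hdt a (List.mem_singleton_self a)
    exact sample_comp_gen h hX ht hP ha (hdP a (List.mem_singleton_self a))
      (fun p hp => hAP p (mem_nodes_paObj.2 hp)) hYP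
      (fun v hv => hl v (mem_nodes_tensorObj.2 (.inl hv))) hl hr
  | id X => exact (isStructural_id X).sample_comp_whiskerLeft h hl hr
  | @comp A B C f g ihf ihg =>
    obtain ⟨hf, hg, hfg⟩ := List.nodup_append.1 hd
    simp only [boxes, List.mem_append] at hdt hdP
    have hm : ∀ v ∈ (Y ⊗ B : FreeMarkov G).nodes, v ∈ X.nodes ∨ v ∈ t := by
      intro v hv
      rcases mem_nodes_tensorObj.1 hv with hv | hv
      · exact hl v (mem_nodes_tensorObj.2 (.inl hv))
      · rcases f.mem_nodes_or_mem_boxes v hv with hv | hv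
        · exact hl v (mem_nodes_tensorObj.2 (.inr hv))
        · exact .inr (hdt v (.inl hv))
    rw [homMk_comp, whiskerLeft_comp, ← Category.assoc,
      ihf hf (fun v hv => hdt v (.inl hv)) hP (fun v hv => hdP v (.inl hv)) hAP hYP hl hm]
    -- After `f` its boxes count as used. The enlarged set is still closed under parents, and it
    -- misses the boxes of `g` because no box occurs twice.
    refine ihg (P := {v | v ∈ P ∨ v ∈ f.boxes}) hg (fun v hv => hdt v (.inr hv)) ?_ ?_ ?_ ?_ hm hr
    · rintro c (hc | hc) hcX p hp
      · exact .inl (hP c hc hcX p hp)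
      · exact f.pa_subset_of_mem_boxes hAP c hc p hp
    · rintro v hv (hv' | hv')
      · exact hdP v (.inr hv) hv'
      · exact hfg v hv' v hv rfl
    · exact fun v hv => (f.mem_nodes_or_mem_boxes v hv).imp_left (hAP v)
    · exact fun v hv => .inl (hYP v hv)
  | whiskerLeft Z f ih =>
    refine left (homMk f) hl hr fun hl' hr' => ih hd hdt hP hdP ?_ ?_ hl' hr'
    · exact fun v hv => hAP v (mem_nodes_tensor.2 (.inr hv))
    · intro v hv
      rcases mem_nodes_tensorObj.1 hv with hv | hv
      · exact hYP v hv
      · exact hAP v (mem_nodes_tensor.2 (.inl hv))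
  | @whiskerRight A B f Z ih =>
    -- Conjugation with the braiding reduces right whiskering to left whiskering.
    have e : homMk (f.whiskerRight Z) = (β_ A Z).hom ≫ Z ◁ homMk f ≫ (β_ Z B).hom := by
      rw [BraidedCategory.braiding_naturality_right, SymmetricCategory.symmetry_assoc]
      rfl
    have hl' : ∀ v ∈ (Y ⊗ (Z ⊗ A) : FreeMarkov G).nodes, v ∈ X.nodes ∨ v ∈ t := by
      simpa [or_comm] using hl
    have hr' : ∀ v ∈ (Y ⊗ (Z ⊗ B) : FreeMarkov G).nodes, v ∈ X.nodes ∨ v ∈ t := by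
      simpa [or_comm] using hr
    change sample X t h (Y ⊗ (A ⊗ Z)) hl ≫ _ = sample X t h (Y ⊗ (B ⊗ Z)) hr
    rw [e, whiskerLeft_comp, whiskerLeft_comp, ← Category.assoc,
      (isStructural_braiding A Z).sample_comp_whiskerLeft h hl hl',
      ← Category.assoc, left (homMk f) hl' hr',
      (isStructural_braiding Z B).sample_comp_whiskerLeft h hr' hr]
    refine fun hl' hr' => ih hd hdt hP hdP ?_ ?_ hl' hr'
    · exact fun v hv => hAP v (mem_nodes_tensor.2 (.inl hv))
    · intro v hv
      rcases mem_nodes_tensorObj.1 hv with hv | hv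
      · exact hYP v hv
      · exact hAP v (mem_nodes_tensor.2 (.inr hv))
  | assoc A B C => exact (isStructural_associator A B C).sample_comp_whiskerLeft h hl hr
  | assocInv A B C =>
    exact (isStructural_associator A B C).inv.sample_comp_whiskerLeft h hl hr
  | leftUnit A => exact (isStructural_leftUnitor A).sample_comp_whiskerLeft h hl hr
  | leftUnitInv A =>
    exact (isStructural_leftUnitor A).inv.sample_comp_whiskerLeft h hl hr
  | rightUnit A => exact (isStructural_rightUnitor A).sample_comp_whiskerLeft h hl hr
  | rightUnitInv A =>
    exact (isStructural_rightUnitor A).inv.sample_comp_whiskerLeft h hl hr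
  | swap A B => exact (isStructural_braiding A B).sample_comp_whiskerLeft h hl hr
  | copy A => exact (isStructural_copy A).sample_comp_whiskerLeft h hl hr
  | discard A => exact (isStructural_discard A).sample_comp_whiskerLeft h hl hr

theorem IsInterventional.eq_sample (h : Generates X t) (hX : ∀ v ∈ t, v ∉ X.nodes) (ht : t.Nodup)
    (hXt : ∀ v, v ∈ X.nodes ∨ v ∈ t) {f : X ⟶ Y} (hf : IsInterventional f) :
    f = sample X t h Y fun v _ => hXt v := by
  obtain ⟨d, rfl, hd⟩ := hf
  obtain ⟨hXn, hdn, hXd⟩ := List.nodup_append.1 hd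
  -- At the start only the inputs are present, and they are exempt from the closure condition, so
  -- `P` can be the set of nodes of `X`.
  have key := sample_comp_homMk (Y := 𝟙_ _) h hX ht d hdn
    (fun v hv => (hXt v).resolve_left fun hv' => hXd v hv' v hv rfl) (P := {v | v ∈ X.nodes})
    (fun c hc hc' => (hc' hc).elim) (fun v hv hv' => hXd v hv' v hv rfl) (fun v hv => hv)
    (fun v hv => (notMem_nodes_unit hv).elim) (fun v _ => hXt v) (fun v _ => hXt v)
  have unit_tensor : ∀ Z : FreeMarkov G, sample X t h (𝟙_ _ ⊗ Z) (fun v _ => hXt v) =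
      sample X t h Z (fun v _ => hXt v) ≫ (λ_ Z).inv := by
    intro Z
    rw [sample, sample, Category.assoc, (isStructural_leftUnitor Z).inv]
  -- Everything generated is discarded again, leaving the inputs, which are distinct.
  have self : ∀ (t : List V) (h : Generates X t),
      sample X t h X (fun v hv => .inl hv) = 𝟙 X := by
    intro t
    induction t with
    | nil => exact fun h => (Category.id_comp _).trans (select_self hXn _)
    | cons b t ih => exact fun h => (sample_cons_of_subset b h _ _).trans (ih h.tail)
  rw [unit_tensor, unit_tensor, self, Category.id_comp, ← leftUnitor_inv_naturality,
    cancel_mono] at key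
  exact key

end FreeMarkov

/-! ### Topological order -/

namespace DAG

variable {V : Type u}

/-- Every finite set of nodes of a DAG has an enumeration in which nodes precede their parents. -/
theorem exists_list_pairwise_not_adj [Finite V] (G : DAG V) (s : Set V) :
    ∃ t : List V, t.Nodup ∧ (∀ v, v ∈ t ↔ v ∈ s) ∧ t.Pairwise fun b a => ¬ G.Adj b a := by
  classical
  have hfin : s.Finite := s.toFinite
  induction hn : s.ncard generalizing s with
  | zero =>
    rw [Set.ncard_eq_zero hfin] at hn
    exact ⟨[], List.nodup_nil, by simp [hn], List.Pairwise.nil⟩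
  | succ n ih =>
    -- The relation is reversed ancestry, so a minimal element of `s` has no descendant in `s` and
    -- may be generated last, at the head of the list.
    let r : V → V → Prop := fun b a => Relation.TransGen G.Adj a b
    have : IsTrans V r := ⟨fun a b c h₁ h₂ => h₂.trans h₁⟩
    have : Std.Irrefl r := ⟨fun a h => G.acyclic a h⟩
    have wf : WellFounded r := Finite.wellFounded_of_trans_of_irrefl r
    obtain ⟨b, hb, hmin⟩ := wf.has_min s
      (Set.nonempty_of_ncard_ne_zero (by omega))
    obtain ⟨t, h₁, h₂, h₃⟩ := ih (s \ {b}) (Set.toFinite _)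
      (by rw [Set.ncard_sdiff_singleton_of_mem hb]; omega)
    refine ⟨b :: t, List.nodup_cons.2 ⟨fun h => ((h₂ b).1 h).2 rfl, h₁⟩, fun v => ?_,
      List.pairwise_cons.2 ⟨fun a ha hba => hmin a ((h₂ a).1 ha).1 (.single hba), h₃⟩⟩
    rw [List.mem_cons, h₂]
    by_cases hv : v = b
    · simp [hv, hb]
    · simp [hv]

theorem not_adj_self (G : DAG V) (a : V) : ¬ G.Adj a a := fun h => G.acyclic a (.single h)

end DAG

/-! ### Uniqueness of interventional morphisms and existence of generating diagrams. -/

namespace FreeMarkov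

open Diagram

variable {V : Type u} {G : DAG V} {X Y : FreeMarkov G}

theorem generates_of_pairwise {t : List V} (ht : t.Pairwise fun b a => ¬ G.Adj b a)
    (h : ∀ b ∈ t, ∀ p ∈ G.pa b, p ∈ X.nodes ∨ p ∈ t) : Generates X t := by
  induction t with
  | nil => trivial
  | cons b t ih =>
    obtain ⟨hb, ht⟩ := List.pairwise_cons.1 ht
    refine ⟨fun p hp => ?_, ih ht fun a ha p hp => ?_⟩
    · refine (h b List.mem_cons_self p hp).imp_right fun h => (List.mem_cons.1 h).resolve_left ?_
      rintro rfl
      exact G.not_adj_self p hp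
    · refine (h a (List.mem_cons_of_mem _ ha) p hp).imp_right fun h =>
        (List.mem_cons.1 h).resolve_left ?_
      rintro rfl
      exact hb a ha hp

/-- Interventional morphisms are determined by their domain and codomain. -/
theorem IsInterventional.unique [Finite V] {f g : X ⟶ Y} (hf : IsInterventional f)
    (hg : IsInterventional g) : f = g := by
  obtain ⟨t, h₁, h₂, h₃⟩ := G.exists_list_pairwise_not_adj {v | v ∉ X.nodes}
  have hXt : ∀ v, v ∈ X.nodes ∨ v ∈ t := fun v => by
    rw [h₂]
    exact Classical.em _
  have h := generates_of_pairwise (X := X) h₃ fun _ _ p _ => hXt p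
  have hX : ∀ v ∈ t, v ∉ X.nodes := fun v hv => (h₂ v).1 hv
  rw [hf.eq_sample h hX h₁ hXt, hg.eq_sample h hX h₁ hXt]

/-- If the parents of the nodes of `s` lie in `X` or in `s`, then there is a diagram generating
from `X` an object `Y` with nodes in `s` that uses exactly the boxes of `s`, each of them once. -/
theorem exists_diagram [Finite V] (s : Set V)
    (hs : ∀ a ∈ s, ∀ p ∈ G.pa a, p ∈ X.nodes ∨ p ∈ s) (hY : ∀ v ∈ Y.nodes, v ∈ s) :
    ∃ d : Diagram G X Y, d.boxes.Nodup ∧ ∀ v ∈ d.boxes, v ∈ s := by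
  obtain ⟨t, h₁, h₂, h₃⟩ := G.exists_list_pairwise_not_adj s
  have h := generates_of_pairwise (X := X) h₃ fun a ha p hp =>
    (hs a ((h₂ a).1 ha) p hp).imp_right (h₂ p).2
  refine ⟨(run X t h).comp (proj _ Y fun v hv => mem_nodes_extend.2 (.inr ((h₂ v).2 (hY v hv)))),
    ?_, ?_⟩
  · simpa [boxes, boxes_run, boxes_proj] using h₁
  · simp [boxes, boxes_run, boxes_proj, h₂]

end FreeMarkov

/-! ### Markov functors between free Markov categories -/

namespace FreeMarkov

open Diagram

variable {V W : Type u} {G : DAG V} {H : DAG W}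

/-- Replacing every node by an object. -/
def mapObj (T : W → FreeMarkov G) : FreeMarkov H → FreeMarkov G
  | of w => T w
  | unit => unit
  | tensor X Y => tensor (mapObj T X) (mapObj T Y)

/-- Replacing every box by a diagram. -/
def mapDiagram (T : W → FreeMarkov G) (B : ∀ w, Diagram G (mapObj T (paObj H w)) (T w)) :
    {X Y : FreeMarkov H} → Diagram H X Y → Diagram G (mapObj T X) (mapObj T Y)
  | _, _, .box w => B w
  | _, _, .id _ => .id _
  | _, _, .comp f g => (mapDiagram T B f).comp (mapDiagram T B g)
  | _, _, .whiskerLeft X f => (mapDiagram T B f).whiskerLeft (mapObj T X)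
  | _, _, .whiskerRight f X => (mapDiagram T B f).whiskerRight (mapObj T X)
  | _, _, .assoc _ _ _ => .assoc _ _ _
  | _, _, .assocInv _ _ _ => .assocInv _ _ _
  | _, _, .leftUnit _ => .leftUnit _
  | _, _, .leftUnitInv _ => .leftUnitInv _
  | _, _, .rightUnit _ => .rightUnit _
  | _, _, .rightUnitInv _ => .rightUnitInv _
  | _, _, .swap _ _ => .swap _ _
  | _, _, .copy _ => .copy _
  | _, _, .discard _ => .discard _

variable (T : W → FreeMarkov G) (B : ∀ w, Diagram G (mapObj T (paObj H w)) (T w))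

theorem rel_mapDiagram {X Y : FreeMarkov H} {f g : Diagram H X Y} (h : Rel f g) :
    Rel (mapDiagram T B f) (mapDiagram T B g) := by
  induction h with
  | symm _ ih => exact ih.symm
  | trans _ _ ih ih' => exact ih.trans ih'
  | comp _ _ ih ih' => exact ih.comp ih'
  | whiskerLeft X _ ih => exact ih.whiskerLeft _
  | whiskerRight X _ ih => exact ih.whiskerRight _
  | refl => exact Rel.refl ..
  | id_comp => exact Rel.id_comp ..
  | comp_id => exact Rel.comp_id ..
  | comp_assoc => exact Rel.comp_assoc ..
  | whiskerLeft_id => exact Rel.whiskerLeft_id ..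
  | id_whiskerRight => exact Rel.id_whiskerRight ..
  | whiskerLeft_comp => exact Rel.whiskerLeft_comp ..
  | comp_whiskerRight => exact Rel.comp_whiskerRight ..
  | exchange => exact Rel.exchange ..
  | assoc_hom_inv => exact Rel.assoc_hom_inv ..
  | assoc_inv_hom => exact Rel.assoc_inv_hom ..
  | leftUnit_hom_inv => exact Rel.leftUnit_hom_inv ..
  | leftUnit_inv_hom => exact Rel.leftUnit_inv_hom ..
  | rightUnit_hom_inv => exact Rel.rightUnit_hom_inv ..
  | rightUnit_inv_hom => exact Rel.rightUnit_inv_hom ..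
  | assoc_nat_left => exact Rel.assoc_nat_left ..
  | assoc_nat_middle => exact Rel.assoc_nat_middle ..
  | assoc_nat_right => exact Rel.assoc_nat_right ..
  | leftUnit_nat => exact Rel.leftUnit_nat ..
  | rightUnit_nat => exact Rel.rightUnit_nat ..
  | pentagon => exact Rel.pentagon ..
  | triangle => exact Rel.triangle ..
  | swap_swap => exact Rel.swap_swap ..
  | swap_nat_right => exact Rel.swap_nat_right ..
  | swap_nat_left => exact Rel.swap_nat_left ..
  | hexagon_forward => exact Rel.hexagon_forward ..
  | hexagon_reverse => exact Rel.hexagon_reverse ..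
  | copy_discard_left => exact Rel.copy_discard_left ..
  | copy_discard_right => exact Rel.copy_discard_right ..
  | copy_assoc => exact Rel.copy_assoc ..
  | copy_swap => exact Rel.copy_swap ..
  | copy_tensor => exact Rel.copy_tensor ..
  | discard_tensor => exact Rel.discard_tensor ..
  | copy_unit => exact Rel.copy_unit ..
  | discard_unit => exact Rel.discard_unit ..
  | discard_nat => exact Rel.discard_nat ..

/-- The functor given by replacing every node by an object and every box by a diagram. -/
def mapFunctor : FreeMarkov H ⥤ FreeMarkov G where
  obj := mapObj T
  map := Quotient.map (mapDiagram T B) fun _ _ => rel_mapDiagram T B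
  map_id _ := rfl
  map_comp := by rintro X Y Z ⟨f⟩ ⟨g⟩; rfl

/-- The functor `mapFunctor` is strictly monoidal. -/
def mapCoreMonoidal : (mapFunctor T B).CoreMonoidal where
  εIso := Iso.refl _
  μIso _ _ := Iso.refl _
  μIso_hom_natural_left := by
    rintro X Y ⟨f⟩ Z
    exact (Category.comp_id _).trans (Category.id_comp _).symm
  μIso_hom_natural_right := by
    rintro X Y Z ⟨f⟩
    exact (Category.comp_id _).trans (Category.id_comp _).symm
  associativity X Y Z := by
    change 𝟙 (mapObj T X ⊗ mapObj T Y) ▷ mapObj T Z ≫ 𝟙 ((mapObj T X ⊗ mapObj T Y) ⊗ mapObj T Z) ≫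
      (α_ (mapObj T X) (mapObj T Y) (mapObj T Z)).hom = (α_ _ _ _).hom ≫
        mapObj T X ◁ 𝟙 (mapObj T Y ⊗ mapObj T Z) ≫ 𝟙 (mapObj T X ⊗ (mapObj T Y ⊗ mapObj T Z))
    simp
  left_unitality X := by
    change _ = 𝟙 (𝟙_ (FreeMarkov G)) ▷ mapObj T X ≫ 𝟙 (𝟙_ (FreeMarkov G) ⊗ mapObj T X) ≫
      (λ_ (mapObj T X)).hom
    simp
    rfl
  right_unitality X := by
    change _ = mapObj T X ◁ 𝟙 (𝟙_ (FreeMarkov G)) ≫ 𝟙 (mapObj T X ⊗ 𝟙_ (FreeMarkov G)) ≫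
      (ρ_ (mapObj T X)).hom
    simp
    rfl

instance mapBraided : (mapFunctor T B).Braided where
  toMonoidal := (mapCoreMonoidal T B).toMonoidal
  braided X Y :=
    (Category.id_comp (β_ (mapObj T X) (mapObj T Y)).hom).trans (Category.comp_id _).symm

/-- The Markov functor given by replacing every node by an object and every box by a diagram. -/
def mapMarkov : MarkovFunctor (FreeMarkov H) (FreeMarkov G) where
  toFunctor := mapFunctor T B
  braided := mapBraided T B
  obj_unit := rfl
  obj_tensor _ _ := rfl
  unit_eq := rfl
  tensor_eq _ _ := rfl
  map_copy _ := (Category.comp_id _).symm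
  map_discard _ := (Category.comp_id _).symm

theorem mem_nodes_mapObj {v : V} {X : FreeMarkov H} :
    v ∈ (mapObj T X).nodes ↔ ∃ w ∈ X.nodes, v ∈ (T w).nodes := by
  induction X with
  | of w => simp [mapObj]
  | unit => simp [mapObj, notMem_nodes_unit]
  | tensor X Y ihX ihY => simp [mapObj, ihX, ihY, or_and_right, exists_or]

theorem nodes_mapObj (X : FreeMarkov H) :
    (mapObj T X).nodes = X.nodes.flatMap fun w => (T w).nodes := by
  induction X with
  | of w => simp [mapObj, nodes]
  | unit => rfl
  | tensor X Y ihX ihY => simp [mapObj, nodes, ihX, ihY]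

theorem boxes_mapDiagram {X Y : FreeMarkov H} (d : Diagram H X Y) :
    (mapDiagram T B d).boxes = d.boxes.flatMap fun w => (B w).boxes := by
  induction d with
  | box w => exact (List.append_nil _).symm
  | comp f g ihf ihg => simp [mapDiagram, boxes, ihf, ihg]
  | whiskerLeft X f ih => exact ih
  | whiskerRight f X ih => exact ih
  | _ => rfl

/-- The image of an object is never a single node. Hence a tensor product whose left factor is a
single node can only be the image of a generator, and the formal product can be decoded uniquely. -/
theorem mapObj_injective (h : ∀ w, ∃ v l, T w = tensor (of v) l) (hT : Function.Injective T) :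
    Function.Injective (mapObj (H := H) T) := by
  have ne_of : ∀ (X : FreeMarkov H) v, mapObj T X ≠ of v := by
    intro X v
    cases X with
    | of w => obtain ⟨_, _, hw⟩ := h w; simp [mapObj, hw]
    | unit => simp [mapObj]
    | tensor => simp [mapObj]
  intro X Y hXY
  induction X generalizing Y with
  | of w =>
    obtain ⟨v, l, hw⟩ := h w
    cases Y with
    | of w' => exact congrArg of (hT hXY)
    | unit => simp [mapObj, hw] at hXY
    | tensor Y Z =>
      simp only [mapObj, hw, tensor.injEq] at hXY
      exact (ne_of _ _ hXY.1.symm).elim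
  | unit =>
    cases Y with
    | of w => obtain ⟨v, l, hw⟩ := h w; simp [mapObj, hw] at hXY
    | unit => rfl
    | tensor => simp [mapObj] at hXY
  | tensor X X' ih ih' =>
    cases Y with
    | of w =>
      obtain ⟨v, l, hw⟩ := h w
      simp only [mapObj, hw, tensor.injEq] at hXY
      exact (ne_of _ _ hXY.1).elim
    | unit => simp [mapObj] at hXY
    | tensor Y Y' =>
      simp only [mapObj, tensor.injEq] at hXY
      rw [ih hXY.1, ih' hXY.2]

end FreeMarkov

/-! ### Territories -/

namespace DAG

variable {V U W : Type u}

/-- To every node `w` of `H` belongs a cluster `cl w` of nodes of `G` and a territory `terr w`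
containing it, such that the territories are disjoint, and the parents of the nodes in `terr w`
belong to `terr w` or to the clusters of the parents of `w`. -/
structure HasTerritories (G : DAG V) (H : DAG W) (cl terr : W → Set V) : Prop where
  nonempty : ∀ w, (cl w).Nonempty
  subset : ∀ w, cl w ⊆ terr w
  eq_of_mem : ∀ {w w' v}, v ∈ terr w → v ∈ terr w' → w = w'
  mem_of_adj : ∀ {w a p}, a ∈ terr w → G.Adj p a → p ∈ terr w ∨ ∃ w', H.Adj w' w ∧ p ∈ cl w'

theorem HasTerritories.finite [Finite V] {G : DAG V} {H : DAG W} {cl terr : W → Set V}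
    (h : G.HasTerritories H cl terr) : Finite W := by
  choose f hf using h.nonempty
  refine Finite.of_injective f fun w w' hw => h.eq_of_mem (h.subset w (hf w)) ?_
  rw [hw]
  exact h.subset w' (hf w')

open FreeMarkov Diagram in
-- Each box is replaced by a diagram generating its cluster within its territory. Disjointness of
-- the territories rules out repetitions, and `IsInterventional.unique` gives faithfulness on
-- interventional morphisms.
theorem HasTerritories.exists_markovFunctor [Finite V] {G : DAG V} {H : DAG W}
    {cl terr : W → Set V} (h : G.HasTerritories H cl terr) :
    ∃ ι : MarkovFunctor (FreeMarkov H) (FreeMarkov G), ι.EmbedsRestr ∧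
      ∀ w, {n | n ∈ (ι.toFunctor.obj (FreeMarkov.of w)).nodes} = cl w := by
  classical
  have := h.finite
  let T : W → FreeMarkov G := fun w => tensorList G (cl w).toFinite.toFinset.toList
  have nodes_T : ∀ w, (T w).nodes = (cl w).toFinite.toFinset.toList := fun w => nodes_tensorList _
  have mem_T : ∀ w v, v ∈ (T w).nodes ↔ v ∈ cl w := fun w v => by simp [nodes_T]
  have nodup_T : ∀ w, (T w).nodes.Nodup := fun w => by
    rw [nodes_T]; exact Finset.nodup_toList _
  have hB : ∀ w, ∃ d : Diagram G (mapObj T (paObj H w)) (T w),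
      d.boxes.Nodup ∧ ∀ v ∈ d.boxes, v ∈ terr w := by
    intro w
    refine exists_diagram (terr w) (fun a ha p hp => ?_) fun v hv => h.subset w ((mem_T w v).1 hv)
    rcases h.mem_of_adj ha hp with hp | ⟨w', hw', hp⟩
    · exact .inr hp
    · exact .inl ((mem_nodes_mapObj T).2 ⟨w', mem_nodes_paObj.2 hw', (mem_T w' p).2 hp⟩)
  choose B hBn hBt using hB
  have flatMap_nodup : ∀ (f : W → List V) (l : List W), (∀ w, (f w).Nodup) →
      (∀ w, ∀ v ∈ f w, v ∈ terr w) → l.Nodup → (l.flatMap f).Nodup := by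
    intro f l hf hft hl
    refine List.nodup_flatMap.2 ⟨fun w _ => hf w, hl.imp fun {w w'} hw v hv hv' => ?_⟩
    exact hw (h.eq_of_mem (hft w v hv) (hft w' v hv'))
  have hTt : ∀ w, ∀ v ∈ (T w).nodes, v ∈ terr w := fun w v hv => h.subset w ((mem_T w v).1 hv)
  have interv : ∀ {X Y : FreeMarkov H} (f : X ⟶ Y), IsInterventional f →
      IsInterventional ((mapMarkov T B).toFunctor.map f) := by
    rintro X Y f ⟨d, rfl, hd⟩
    refine ⟨mapDiagram T B d, rfl, ?_⟩
    obtain ⟨hX, hd, hXd⟩ := List.nodup_append.1 hd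
    change ((mapObj T X).nodes ++ (mapDiagram T B d).boxes).Nodup
    rw [nodes_mapObj, boxes_mapDiagram]
    refine List.nodup_append.2 ⟨flatMap_nodup _ _ nodup_T hTt hX, flatMap_nodup _ _ hBn hBt hd, ?_⟩
    rintro v hv v' hv' rfl
    obtain ⟨w, hw, hv⟩ := List.mem_flatMap.1 hv
    obtain ⟨w', hw', hv'⟩ := List.mem_flatMap.1 hv'
    exact hXd w hw w' hw' (h.eq_of_mem (hTt w v hv) (hBt w' v hv'))
  refine ⟨mapMarkov T B, ⟨?_, ?_, interv, fun f g hf hg _ => hf.unique hg⟩, fun w => ?_⟩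
  · refine mapObj_injective T (fun w => ?_) fun w w' hw => ?_
    · obtain ⟨v, hv⟩ := h.nonempty w
      have hv' : v ∈ (cl w).toFinite.toFinset.toList := by simpa using hv
      change ∃ v l, tensorList G (cl w).toFinite.toFinset.toList = tensor (of v) l
      generalize (cl w).toFinite.toFinset.toList = l at hv'
      cases l with
      | nil => simp at hv'
      -- A nonempty list gives a formal tensor product even when it has one entry, because
      -- `tensorList` ends with the unit.
      | cons a l => exact ⟨a, _, rfl⟩
    · obtain ⟨v, hv⟩ := h.nonempty w
      refine h.eq_of_mem (h.subset w hv) (h.subset w' ((mem_T w' v).1 ?_))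
      rw [← hw]
      exact (mem_T w v).2 hv
  · rintro X Y f ⟨d, rfl, hd⟩
    refine ⟨mapDiagram T B d, rfl, ?_⟩
    have := flatMap_nodup _ _ hBn hBt hd
    rw [← boxes_mapDiagram T B d] at this
    exact this
  · exact Set.ext fun v => mem_T w v

/-- A graphical abstraction has territories. -/
theorem AbstractsTo.exists_territories {G : DAG V} {X : Set V} {H : DAG W} {cl : W → Set V}
    (h : G.AbstractsTo X H cl) :
    ∃ terr, G.HasTerritories H cl terr ∧
      (∀ p w, H.Adj p w → ∃ x ∈ cl p, ∃ y ∈ terr w, G.Adj x y) ∧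
      ∀ w, Disjoint (cl w) X ∨ ∃ x ∈ X, cl w = {x} := by
  induction h with
  | rename H e he =>
    refine ⟨fun w => {e w}, ⟨fun w => Set.singleton_nonempty _, fun w => subset_rfl, ?_, ?_⟩, ?_, ?_⟩
    · rintro w w' v h h'
      exact e.injective ((Set.mem_singleton_iff.1 h).symm.trans h')
    · rintro w a p rfl hp
      exact .inr ⟨e.symm p, (he _ _).2 (by simpa using hp), by simp⟩
    · exact fun p w hpw => ⟨e p, rfl, e w, rfl, (he _ _).1 hpw⟩
    · intro w
      by_cases hw : e w ∈ X
      · exact .inr ⟨e w, hw, rfl⟩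
      · exact .inl (Set.disjoint_singleton_left.2 hw)
  | @delete W W' H cl H' a e _ h ih =>
    obtain ⟨terr, ht, hadj, hX⟩ := ih
    have surj : ∀ w, w ≠ a → ∃ w', e w' = w := fun w hw => by
      have : w ∈ Set.range e := by rw [h.range_eq]; exact hw
      exact this
    have ne : ∀ w, e w ≠ a := fun w => by
      have : e w ∈ ({a}ᶜ : Set W) := h.range_eq ▸ Set.mem_range_self w
      exact this
    -- The territory of the deleted node passes to its child. As there is at most one child, the
    -- territories stay disjoint.
    refine ⟨fun w => {n | n ∈ terr (e w) ∨ (H.Adj a (e w) ∧ n ∈ terr a)},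
      ⟨fun w => ht.nonempty _, fun w n hn => .inl (ht.subset _ hn), ?_, ?_⟩, ?_, fun w => hX _⟩
    · rintro w w' v (hv | ⟨hw, hv⟩) (hv' | ⟨hw', hv'⟩)
      · exact h.injective (ht.eq_of_mem hv hv')
      · exact (ne w (ht.eq_of_mem hv hv')).elim
      · exact (ne w' (ht.eq_of_mem hv' hv)).elim
      · exact h.injective (h.not_confounder _ _ hw hw')
    · rintro w b p (hb | ⟨hw, hb⟩) hp
      · rcases ht.mem_of_adj hb hp with hp | ⟨q, hq, hp⟩
        · exact .inl (.inl hp)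
        · by_cases hqa : q = a
          -- The cluster of the deleted parent now lies in the territory of its child.
          · subst hqa
            exact .inl (.inr ⟨hq, ht.subset _ hp⟩)
          · obtain ⟨q, rfl⟩ := surj q hqa
            exact .inr ⟨q, (h.adj_iff _ _).2 (.inl hq), hp⟩
      · rcases ht.mem_of_adj hb hp with hp | ⟨q, hq, hp⟩
        · exact .inl (.inr ⟨hw, hp⟩)
        · obtain ⟨q, rfl⟩ := surj q (by rintro rfl; exact H.not_adj_self _ hq)
          exact .inr ⟨q, (h.adj_iff _ _).2 (.inr ⟨hq, hw⟩), hp⟩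
    · intro p w hpw
      rcases (h.adj_iff _ _).1 hpw with hpw | ⟨hp, hw⟩
      · obtain ⟨x, hx, y, hy, hxy⟩ := hadj _ _ hpw
        exact ⟨x, hx, y, .inl hy, hxy⟩
      · obtain ⟨x, hx, y, hy, hxy⟩ := hadj _ _ hp
        exact ⟨x, hx, y, .inr ⟨hw, hy⟩, hxy⟩
  | @merge W W' H cl H' a b f _ ha hb h ih =>
    obtain ⟨terr, ht, hadj, hX⟩ := ih
    refine ⟨fun w => {n | ∃ x, f x = w ∧ n ∈ terr x},
      ⟨fun w => ?_, ?_, ?_, ?_⟩, ?_, fun w => ?_⟩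
    · obtain ⟨x, rfl⟩ := h.surjective w
      obtain ⟨n, hn⟩ := ht.nonempty x
      exact ⟨n, x, rfl, hn⟩
    · rintro w n ⟨x, hx, hn⟩
      exact ⟨x, hx, ht.subset x hn⟩
    · rintro w w' v ⟨x, rfl, hx⟩ ⟨y, rfl, hy⟩
      rw [ht.eq_of_mem hx hy]
    · rintro w c p ⟨x, rfl, hc⟩ hp
      rcases ht.mem_of_adj hc hp with hp | ⟨q, hq, hp⟩
      · exact .inl ⟨x, rfl, hp⟩
      · by_cases hqx : f q = f x
        -- An edge between the two merged nodes becomes internal to the new territory.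
        · exact .inl ⟨q, hqx, ht.subset q hp⟩
        · exact .inr ⟨f q, (h.adj_iff _ _).2 ⟨hqx, q, x, rfl, rfl, hq⟩, q, rfl, hp⟩
    · intro p w hpw
      obtain ⟨-, x, y, rfl, rfl, hxy⟩ := (h.adj_iff _ _).1 hpw
      obtain ⟨n, hn, m, hm, hnm⟩ := hadj _ _ hxy
      exact ⟨n, ⟨x, rfl, hn⟩, m, ⟨y, rfl, hm⟩, hnm⟩
    · obtain ⟨x, rfl⟩ := h.surjective w
      by_cases hx : x = a ∨ x = b
      · left
        rw [Set.disjoint_left]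
        rintro n ⟨y, hy, hn⟩
        have hy' : y = a ∨ y = b := by
          rcases (h.eq_iff _ _).1 hy with rfl | ⟨rfl, -⟩ | ⟨rfl, -⟩ <;> tauto
        rcases hy' with rfl | rfl
        · exact Set.disjoint_left.1 ha hn
        · exact Set.disjoint_left.1 hb hn
      · have e : {n | ∃ y, f y = f x ∧ n ∈ cl y} = cl x := by
          ext n
          refine ⟨?_, fun hn => ⟨x, rfl, hn⟩⟩
          rintro ⟨y, hy, hn⟩
          rcases (h.eq_iff _ _).1 hy with rfl | ⟨-, rfl⟩ | ⟨-, rfl⟩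
          · exact hn
          · exact (hx (.inr rfl)).elim
          · exact (hx (.inl rfl)).elim
        simp only [e]
        exact hX x

/-! ### Replacing exogenous nodes -/

/-- A longer path would have to enter an exogenous node, which has no parents. -/
theorem latentPath_inl_iff {G : DAG (V ⊕ U)} (hG : ∀ x : U, G.pa (Sum.inr x) = ∅) {v w : V} :
    G.LatentPath (Sum.inl v) w ↔ G.Adj (Sum.inl v) (Sum.inl w) := by
  refine ⟨fun h => ?_, .edge⟩
  cases h with
  | edge h => exact h
  | step h _ => simp [Adj, hG] at h

theorem latentPath_inr_iff {G : DAG (V ⊕ U)} (hG : ∀ x : U, G.pa (Sum.inr x) = ∅) {x : U} {w : V} :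
    G.LatentPath (Sum.inr x) w ↔ G.Adj (Sum.inr x) (Sum.inl w) := by
  refine ⟨fun h => ?_, .edge⟩
  cases h with
  | edge h => exact h
  | step h _ => simp [Adj, hG] at h

theorem Represents.dir_iff {G : DAG (V ⊕ U)} {L : ADMG V} (h : G.Represents L) {v w : V} :
    L.Dir v w ↔ G.Adj (Sum.inl v) (Sum.inl w) := by
  rw [← h.latentProjection_eq]
  exact latentPath_inl_iff h.exogenous

theorem Represents.bidir_iff {G : DAG (V ⊕ U)} {L : ADMG V} (h : G.Represents L) {v w : V} :
    L.Bidir v w ↔ v ≠ w ∧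
      ∃ x : U, G.Adj (Sum.inr x) (Sum.inl v) ∧ G.Adj (Sum.inr x) (Sum.inl w) := by
  rw [← h.latentProjection_eq]
  exact and_congr_right fun _ => exists_congr fun x =>
    and_congr (latentPath_inr_iff h.exogenous) (latentPath_inr_iff h.exogenous)

end DAG

/-- The DAG consisting of the directed edges of an ADMG and of exogenous nodes with prescribed
children. -/
noncomputable def ADMG.withExogenous {W U : Type u} [Finite W] [Finite U] (H : ADMG W)
    (c : U → W → Prop) : DAG (W ⊕ U) where
  pa := Sum.elim (fun w => (Set.toFinite
    {x : W ⊕ U | Sum.elim (fun w' => H.Dir w' w) (fun u => c u w) x}).toFinset) fun _ => ∅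
  acyclic := by
    -- No edge enters an exogenous node, so every path ends in an endogenous one, and a cycle would
    -- be a cycle of directed edges of `H`.
    have key : ∀ x y : W ⊕ U, Relation.TransGen (fun x y => x ∈ Sum.elim (fun w => (Set.toFinite
        {x : W ⊕ U | Sum.elim (fun w' => H.Dir w' w) (fun u => c u w) x}).toFinset)
          (fun _ => (∅ : Finset (W ⊕ U))) y) x y →
        ∃ w', y = Sum.inl w' ∧ ∀ w, x = Sum.inl w → Relation.TransGen H.Dir w w' := by
      intro x y h
      induction h with
      | @single y h =>
        rcases y with w' | u
        · refine ⟨w', rfl, ?_⟩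
          rintro w rfl
          exact .single (by simpa using h)
        · simp at h
      | @tail y z _ h ih =>
        obtain ⟨w', rfl, hw'⟩ := ih
        rcases z with w | u
        · exact ⟨w, rfl, fun v hv => (hw' v hv).tail (by simpa using h)⟩
        · simp at h
    intro x hx
    obtain ⟨w, rfl, hw⟩ := key x x hx
    exact H.acyclic w (hw w rfl)

namespace ADMG

variable {W U : Type u} [Finite W] [Finite U] {H : ADMG W} {c : U → W → Prop}

theorem withExogenous_pa_inr (u : U) : (H.withExogenous c).pa (Sum.inr u) = ∅ := rfl

theorem withExogenous_adj_inl {w w' : W} :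
    (H.withExogenous c).Adj (Sum.inl w) (Sum.inl w') ↔ H.Dir w w' := by
  simp [DAG.Adj, withExogenous]

theorem withExogenous_adj_inr {u : U} {w : W} :
    (H.withExogenous c).Adj (Sum.inr u) (Sum.inl w) ↔ c u w := by
  simp [DAG.Adj, withExogenous]

theorem withExogenous_represents
    (hc : ∀ w w', H.Bidir w w' ↔ w ≠ w' ∧ ∃ u, c u w ∧ c u w') :
    (H.withExogenous c).Represents H := by
  refine ⟨withExogenous_pa_inr, ?_⟩
  ext w w'
  · exact (DAG.latentPath_inl_iff withExogenous_pa_inr).trans withExogenous_adj_inl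
  · rw [hc]
    refine and_congr_right fun _ => exists_congr fun u => and_congr ?_ ?_ <;>
      exact (DAG.latentPath_inr_iff withExogenous_pa_inr).trans withExogenous_adj_inr

end ADMG

/-- A graphical abstraction between ADMGs of `L` is, for every DAG `L'` representing `L`, realized
by territories in `L'` of some DAG representing the abstraction. -/
theorem ADMG.IsGraphicalAbstraction.exists_hasTerritories {V U W : Type u} [Finite V] [Finite U]
    {L : ADMG V} {L' : DAG (V ⊕ U)} (hL' : L'.Represents L) {H : ADMG W} {K : W → Set V}
    (hH : L.IsGraphicalAbstraction H K) :
    ∃ (U' : Type u) (_ : Finite U') (H' : DAG (W ⊕ U')) (cl terr : W ⊕ U' → Set (V ⊕ U)),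
      H'.Represents H ∧ L'.HasTerritories H' cl terr ∧ ∀ w, cl (Sum.inl w) = Sum.inl '' K w := by
  obtain ⟨U₁, U₂, _, _, L₁, H₁, cl, hL₁, hH₁, habs, hcl⟩ := hH
  obtain ⟨terr, ht, hadj, hX⟩ := habs.exists_territories
  have : Finite (W ⊕ U₂) := ht.finite
  have : Finite W := Finite.of_injective (Sum.inl : W → W ⊕ U₂) Sum.inl_injective
  -- These are the nodes with purely endogenous clusters. Since exogenous nodes are never merged,
  -- every other cluster is a single exogenous node of `L₁`, so one endogenous member already forces
  -- `E`.
  let E : W ⊕ U₂ → Prop := fun x => Disjoint (cl x) (Set.range Sum.inr)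
  have hE : ∀ x, E x → ∀ u, Sum.inr u ∉ cl x := fun x hx u hu =>
    Set.disjoint_left.1 hx hu ⟨u, rfl⟩
  have E_of_mem : ∀ x v, Sum.inl v ∈ cl x → E x := by
    intro x v hv
    refine (hX x).resolve_right ?_
    rintro ⟨_, ⟨u, rfl⟩, hu⟩
    simp [hu] at hv
  have E_inl : ∀ w, E (Sum.inl w) := by
    intro w
    obtain ⟨n, hn⟩ := ht.nonempty (Sum.inl w)
    have hn' := hn
    rw [hcl] at hn'
    obtain ⟨v, _, rfl⟩ := hn'
    exact E_of_mem _ v hn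
  -- Two nodes whose territories have a common exogenous parent have one in `H₁`.
  have common₁ : ∀ x x', x ≠ x' → E x → E x' → ∀ y ∈ terr x, ∀ y' ∈ terr x', ∀ u,
      L₁.Adj (Sum.inr u) y → L₁.Adj (Sum.inr u) y' → ∃ p, H₁.Adj p x ∧ H₁.Adj p x' ∧ ¬ E p := by
    intro x x' hxx' hx hx' y hy y' hy' u hu hu'
    rcases ht.mem_of_adj hy hu with h | ⟨p, hp, h⟩ <;>
      rcases ht.mem_of_adj hy' hu' with h' | ⟨p', hp', h'⟩
    · exact (hxx' (ht.eq_of_mem h h')).elim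
    · obtain rfl := ht.eq_of_mem h (ht.subset _ h')
      exact (hE _ hx u h').elim
    · obtain rfl := ht.eq_of_mem h' (ht.subset _ h)
      exact (hE _ hx' u h).elim
    · obtain rfl := ht.eq_of_mem (ht.subset _ h) (ht.subset _ h')
      exact ⟨p, hp, hp', fun hp => hE _ hp u h⟩
  -- A common exogenous parent in `L'` is carried to `L₁` through the bidirected edge of `L`. The
  -- resulting common parent in `H₁` is exogenous, as its cluster is not purely endogenous.
  have common : ∀ x x', x ≠ x' → E x → E x' → ∀ v, Sum.inl v ∈ terr x → ∀ v', Sum.inl v' ∈ terr x' →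
      ∀ u, L'.Adj (Sum.inr u) (Sum.inl v) → L'.Adj (Sum.inr u) (Sum.inl v') →
        ∃ p : U₂, H₁.Adj (Sum.inr p) x ∧ H₁.Adj (Sum.inr p) x' := by
    intro x x' hxx' hx hx' v hv v' hv' u hu hu'
    have hvv' : v ≠ v' := by
      rintro rfl
      exact hxx' (ht.eq_of_mem hv hv')
    obtain ⟨-, u₁, hu₁, hu₁'⟩ := hL₁.bidir_iff.1 (hL'.bidir_iff.2 ⟨hvv', u, hu, hu'⟩)
    obtain ⟨p, hp, hp', hpE⟩ := common₁ x x' hxx' hx hx' _ hv _ hv' u₁ hu₁ hu₁'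
    rcases p with w | p
    · exact (hpE (E_inl w)).elim
    · exact ⟨p, hp, hp'⟩
  have not_adj_inr : ∀ x (p : U₂), ¬ H₁.Adj x (Sum.inr p) := fun x p h => by
    simp [DAG.Adj, hH₁.exogenous] at h
  have not_adj_inr' : ∀ x (u : U), ¬ L'.Adj x (Sum.inr u) := fun x p h => by
    simp [DAG.Adj, hL'.exogenous] at h
  -- If the nodes were different, the exogenous node `p` would acquire a parent in `H₁`. So an
  -- absorbed node of `L'` has no children in any other territory of a node satisfying `E`.
  have eq_of_common : ∀ x (p : U₂), E x → E (Sum.inr p) → ∀ v, Sum.inl v ∈ terr x → ∀ v',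
      Sum.inl v' ∈ terr (Sum.inr p) → ∀ u, L'.Adj (Sum.inr u) (Sum.inl v) →
        L'.Adj (Sum.inr u) (Sum.inl v') → x = Sum.inr p := by
    intro x p hx hp v hv v' hv' u hu hu'
    by_contra hne
    obtain ⟨q, -, hq⟩ := common x _ hne hx hp v hv v' hv' u hu hu'
    exact not_adj_inr _ _ hq
  -- Edges between the endogenous nodes of `L'`.
  have dir : ∀ x, E x → ∀ v, Sum.inl v ∈ terr x → ∀ v', L'.Adj (Sum.inl v') (Sum.inl v) →
      Sum.inl v' ∈ terr x ∨ ∃ p, E p ∧ H₁.Adj p x ∧ Sum.inl v' ∈ cl p := by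
    intro x hx v hv v' hv'
    refine (ht.mem_of_adj hv (hL₁.dir_iff.1 (hL'.dir_iff.2 hv'))).imp_right ?_
    rintro ⟨p, hp, h⟩
    exact ⟨p, E_of_mem p v' h, hp, h⟩
  -- The exogenous nodes of `H'`: those of `H₁` that come from endogenous nodes, and those of `L'`
  -- that are not absorbed by them.
  let absorbed : U₂ → U → Prop := fun p u =>
    ∃ v, Sum.inl v ∈ terr (Sum.inr p) ∧ L'.Adj (Sum.inr u) (Sum.inl v)
  let U' : Type u := {p : U₂ // E (Sum.inr p)} ⊕ {u : U // ∀ p, E (Sum.inr p) → ¬ absorbed p u}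
  let c : U' → W → Prop := Sum.elim (fun p w => H₁.Adj (Sum.inr p.1) (Sum.inl w))
    fun u w => ∃ v, Sum.inl v ∈ terr (Sum.inl w) ∧ L'.Adj (Sum.inr u.1) (Sum.inl v)
  let cl' : W ⊕ U' → Set (V ⊕ U) := Sum.elim (fun w => Sum.inl '' K w)
    (Sum.elim (fun p => {n | ∃ v, n = Sum.inl v ∧ Sum.inl v ∈ cl (Sum.inr p.1)})
      fun u => {Sum.inr u.1})
  -- Nodes of `W` keep only the endogenous part of their territory, so all their exogenous parents
  -- become parents in `H'`. An exogenous node of `H'` must have no parents, so its territory has to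
  -- swallow the exogenous parents of its members.
  let terr' : W ⊕ U' → Set (V ⊕ U) := Sum.elim
    (fun w => {n | ∃ v, n = Sum.inl v ∧ Sum.inl v ∈ terr (Sum.inl w)})
    (Sum.elim (fun p => {n | (∃ v, n = Sum.inl v ∧ Sum.inl v ∈ terr (Sum.inr p.1)) ∨
      ∃ u, n = Sum.inr u ∧ absorbed p.1 u}) fun u => {Sum.inr u.1})
  refine ⟨U', inferInstance, H.withExogenous c, cl', terr', ADMG.withExogenous_represents ?_,
    ⟨?_, ?_, ?_, ?_⟩, fun w => rfl⟩
  · intro w w'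
    rw [hH₁.bidir_iff]
    refine and_congr_right fun hww' => ⟨?_, ?_⟩
    · rintro ⟨p, hp, hp'⟩
      by_cases hpE : E (Sum.inr p)
      · exact ⟨.inl ⟨p, hpE⟩, hp, hp'⟩
      -- Here `p` comes from one exogenous node `u₁` of `L₁`, which has children in both
      -- territories. The bidirected edge of `L` between these children provides a node of `L'` in
      -- its place, and by `eq_of_common` that node is not absorbed.
      · obtain ⟨_, ⟨u₁, rfl⟩, hu₁⟩ := (hX (Sum.inr p)).resolve_left hpE
        obtain ⟨x, hx, y, hy, hxy⟩ := hadj _ _ hp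
        obtain ⟨x', hx', y', hy', hxy'⟩ := hadj _ _ hp'
        rw [hu₁] at hx hx'
        obtain rfl := hx
        obtain rfl := hx'
        rcases y with v | u
        swap
        · simp [DAG.Adj, hL₁.exogenous] at hxy
        rcases y' with v' | u
        swap
        · simp [DAG.Adj, hL₁.exogenous] at hxy'
        have hvv' : v ≠ v' := by
          rintro rfl
          exact hww' (Sum.inl_injective (ht.eq_of_mem hy hy'))
        obtain ⟨-, u, hu, hu'⟩ := hL'.bidir_iff.1 (hL₁.bidir_iff.2 ⟨hvv', u₁, hxy, hxy'⟩)
        refine ⟨.inr ⟨u, ?_⟩, ⟨v, hy, hu⟩, ⟨v', hy', hu'⟩⟩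
        rintro q hq ⟨v'', hv'', hu''⟩
        exact Sum.inl_ne_inr (eq_of_common _ q (E_inl w) hq v hy v'' hv'' u hu hu'')
    · rintro ⟨p | u, hc, hc'⟩
      · exact ⟨p, hc, hc'⟩
      · obtain ⟨v, hv, hu⟩ := hc
        obtain ⟨v', hv', hu'⟩ := hc'
        exact common _ _ (fun h => hww' (Sum.inl_injective h)) (E_inl w) (E_inl w') v hv v' hv'
          u hu hu'
  · rintro (w | p | u)
    · obtain ⟨n, hn⟩ := ht.nonempty (Sum.inl w)
      rw [hcl] at hn
      obtain ⟨v, hv, -⟩ := hn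
      exact ⟨_, v, hv, rfl⟩
    · obtain ⟨n | u, hn⟩ := ht.nonempty (Sum.inr p.1)
      · exact ⟨_, n, rfl, hn⟩
      · exact (hE _ p.2 u hn).elim
    · exact Set.singleton_nonempty _
  · rintro (w | p | u)
    · rintro _ ⟨v, hv, rfl⟩
      exact ⟨v, rfl, ht.subset _ (by rw [hcl]; exact ⟨v, hv, rfl⟩)⟩
    · rintro _ ⟨v, rfl, hv⟩
      exact .inl ⟨v, rfl, ht.subset _ hv⟩
    · exact subset_rfl
  · rintro (w | p | u) (w' | p' | u') (v | n) hv hv' <;>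
      simp only [terr', Sum.elim_inl, Sum.elim_inr, Set.mem_ofPred_eq, Set.mem_singleton_iff,
        Sum.inl.injEq, Sum.inr.injEq, reduceCtorEq, false_and, exists_false, or_false, false_or,
        exists_eq_left'] at hv hv'
    · rw [Sum.inl_injective (ht.eq_of_mem hv hv')]
    · exact (Sum.inl_ne_inr (ht.eq_of_mem hv hv')).elim
    · exact (Sum.inl_ne_inr (ht.eq_of_mem hv' hv)).elim
    · rw [Subtype.ext (Sum.inr_injective (ht.eq_of_mem hv hv'))]
    -- Two nodes absorbing the same exogenous node have a common exogenous parent in their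
    -- territories, so they coincide.
    · obtain ⟨v, hv, hu⟩ := hv
      obtain ⟨v', hv', hu'⟩ := hv'
      rw [Subtype.ext (Sum.inr_injective (eq_of_common _ _ p.2 p'.2 v hv v' hv' n hu hu'))]
    · subst hv'
      exact (u'.2 _ p.2 hv).elim
    · subst hv
      exact (u.2 _ p'.2 hv').elim
    · rw [Subtype.ext (hv.symm.trans hv')]
  · rintro (w | p | u) (v | n) q hv hq
    · obtain ⟨_, ⟨⟩, hv⟩ := hv
      rcases q with v' | u
      · rcases dir _ (E_inl w) v hv v' hq with h | ⟨p, hp, hpw, h⟩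
        · exact .inl ⟨v', rfl, h⟩
        · rcases p with w' | p
          · refine .inr ⟨.inl w', ADMG.withExogenous_adj_inl.2 (hH₁.dir_iff.2 hpw), ?_⟩
            rw [hcl] at h
            obtain ⟨v'', hv'', h⟩ := h
            obtain rfl := Sum.inl_injective h
            exact ⟨v'', hv'', rfl⟩
          · exact .inr ⟨.inr (.inl ⟨p, hp⟩), ADMG.withExogenous_adj_inr.2 hpw, v', rfl, h⟩
      -- An exogenous parent of the territory of an endogenous node cannot be absorbed, so it is
      -- itself a node of `H'`.
      · refine .inr ⟨.inr (.inr ⟨u, ?_⟩), ADMG.withExogenous_adj_inr.2 ⟨v, hv, hq⟩, rfl⟩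
        rintro p hp ⟨v', hv', hu'⟩
        exact Sum.inl_ne_inr (eq_of_common _ p (E_inl w) hp v hv v' hv' u hq hu')
    · exact (not_adj_inr' _ _ hq).elim
    · obtain ⟨_, ⟨⟩, hv⟩ | ⟨_, ⟨⟩, _⟩ := hv
      rcases q with v' | u
      · rcases dir _ p.2 v hv v' hq with h | ⟨_, _, h, _⟩
        · exact .inl (.inl ⟨v', rfl, h⟩)
        · exact (not_adj_inr _ _ h).elim
      · exact .inl (.inr ⟨u, rfl, v, hv, hq⟩)
    · exact (not_adj_inr' _ _ hq).elim
    · exact (Sum.inl_ne_inr hv).elim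
    · exact (not_adj_inr' _ _ hq).elim

theorem mainTheorem7
    {V U W : Type u} [Finite V] [Finite U]
    {M : Type u₁} [Category.{v₁} M] [MonoidalCategory.{v₁} M] [MarkovCategory M]
    (L : ADMG V) (L' : DAG (V ⊕ U)) (F : CausalModel L' M) (hF : F.IsOverADMG L)
    (H : ADMG W) (K : W → Set (V ⊕ U))
    (hH : (∃ K₀ : W → Set V, L.IsGraphicalAbstraction H K₀ ∧ ∀ w, K w = Sum.inl '' K₀ w) ∨
      L'.HasADMGAbstraction H K) :
    ∃ (U' : Type u) (_ : Finite U') (H' : DAG (W ⊕ U'))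
      (ι : MarkovFunctor (FreeMarkov H') (FreeMarkov L')),
      ι.EmbedsRestr ∧
      (∀ w : W, {n | n ∈ (ι.toFunctor.obj (FreeMarkov.of (Sum.inl w))).nodes} = K w) ∧
      (F.restrict ι).IsOverADMG H := by
  rcases hH with ⟨K₀, hH, hK⟩ | ⟨U', hU', H', cl, hH', habs, hcl⟩
  · obtain ⟨U', hU', H', cl, terr, hH', ht, hcl⟩ := hH.exists_hasTerritories hF
    obtain ⟨ι, hι, hιcl⟩ := ht.exists_markovFunctor
    exact ⟨U', hU', H', ι, hι, fun w => by rw [hιcl, hcl, hK], hH'⟩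
  -- The abstracted DAG is `L'` itself, so no change of exogenous nodes is needed and the
  -- abstraction serves directly as the new DAG.
  · obtain ⟨terr, ht, -⟩ := habs.exists_territories
    obtain ⟨ι, hι, hιcl⟩ := ht.exists_markovFunctor
    exact ⟨U', hU', H', ι, hι, fun w => by rw [hιcl, hcl], hH'⟩
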